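/- Work in the field $\mathbb{Q}(\!(q)\!)$ of formal Laurent series with its $q$-adic topology, and for $n\ge 0$ let $[n]_q=1+q+\cdots+q^{n-1}$ and $[n]_{q^{-1}}=1+q^{-1}+\cdots+q^{-(n-1)}$. Write $$\frac{\alpha_0}{\beta_0}\,{\scriptstyle +}\,\frac{\alpha_1}{\beta_1}\,{\scriptstyle +}\,\frac{\alpha_2}{\beta_2}\,{\scriptstyle +}\cdots:=\cfrac{\alpha_0}{\beta_0+\cfrac{\alpha_1}{\beta_1+\cfrac{\alpha_2}{\beta_2+\cdots}}}$$ for a finite or infinite continued fraction (the limit of its convergents, if infinite), $\mathbf{K}_{i=0}^{m}(\cdots)$ for the concatenation of the indicated partial quotients for $i=0,\dots,m$ (empty if $m<0$), and $(\cdots)^*$ for a block of partial quotients that is repeated indefinitely. An *$H$-fraction* (Hankel continued fraction) over a field $\mathbb{F}$ is a finite or infinite continued fraction of the form $$\frac{v_0q^{k_0}}{1+qu_1(q)}\,{\scriptstyle +}\,\frac{-v_1q^{k_0+k_1+2}}{1+qu_2(q)}\,{\scriptstyle +}\,\frac{-v_2q^{k_1+k_2+2}}{1+qu_3(q)}\,{\scriptstyle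 +}\cdots$$ with $v_i\in\mathbb{F}\setminus\{0\}$, $k_i\in\mathbb{Z}_{\ge0}$ and polynomials $u_i\in\mathbb{F}[q]$ with $\deg u_i\le k_{i-1}$. For $n\ge1$ the $q$-deformed metallic number is $$\Phi_n(q)=[n]_q+\left(\frac{q^n}{[n]_{q^{-1}}}\,{\scriptstyle +}\,\frac{q^{-n}}{[n]_q}\,{\scriptstyle +}\right)^*\in\mathbb{Q}(\!(q)\!).$$ **Theorem.** Let $n\ge2$. The continued fraction defining $\Phi_n(q)$ converges. Put $$\langle n\rangle_q:=q[n]_q+(1+q^n)(1-q)=1+\sum_{i=2}^{n-1}q^i+2q^n-q^{n+1}.$$ Then $\Phi_n(q)$ has exactly one $H$-fraction expansion over $\mathbb{Q}$, and this expansion is $$\Phi_n(q)=\frac{1}{1-q}\,{\scriptstyle +}\,\bigl(U_n(q)\,{\scriptstyle +}\,V_n(q)\,{\scriptstyle +}\,W_n(q)\,{\scriptstyle +}\bigr)^*,$$ where $$U_n(q)=\mathbf{K}_{i=0}^{n-3}\left(\frac{q^{n-i}}{[n-i]_q}\,{\scriptstyle +}\,\frac{q^n}{[i+2]_q-q}\,{\scriptstyle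 +}\,\frac{q^{i+2}}{1-q}\right)\,{\scriptstyle +}\,\frac{q^2}{[2]_q}\,{\scriptstyle +}\,\frac{q^n}{[n]_q-q}\,{\scriptstyle +}\,\frac{q^n}{1},$$ $$V_n(q)=\frac{-q^{n+1}}{\langle n\rangle_q+q^{n+1}}\,{\scriptstyle +}\,\frac{q^{2n+1}}{\langle n\rangle_q}\,{\scriptstyle +}\,\frac{q^{2n+1}}{\langle n\rangle_q+q^{n+1}}\,{\scriptstyle +}\,\frac{-q^{n+1}}{1},$$ $$W_n(q)=\mathbf{K}_{i=0}^{n-3}\left(\frac{q^{n-i}}{[n-i]_q-q}\,{\scriptstyle +}\,\frac{q^n}{[i+2]_q}\,{\scriptstyle +}\,\frac{q^{i+2}}{1-q}\right)\,{\scriptstyle +}\,\frac{q^2}{1}.$$ It is $(6n-4)$-periodic with offset $1$: if $\alpha_i/\beta_i$ ($i\ge0$) denotes its $i$-th partial quotient, then $\alpha_{i+6n-4}=\alpha_i$ and $\beta_{i+6n-4}=\beta_i$ for all $i\ge1$. -/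

import Mathlib

open Filter Topology

noncomputable section

namespace QMetallic

/-- The `q`-integer `[n]_x = 1 + x + ⋯ + x ^ (n - 1)`. -/
def qInt {R : Type*} [CommRing R] (x : R) (n : ℕ) : R :=
  ∑ i ∈ Finset.range n, x ^ i

/-- The element `⟨n⟩_x = x [n]_x + (1 + x ^ n) (1 - x)`. -/
def qAngle {R : Type*} [CommRing R] (x : R) (n : ℕ) : R :=
  x * qInt x n + (1 + x ^ n) * (1 - x)

/-- The indeterminate `q` of the field of formal Laurent series in `q` over `F`. -/
def q (F : Type*) [Field F] : LaurentSeries F :=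
  HahnSeries.single 1 1

/-- A (finite or infinite) continued fraction over the field of formal Laurent series converges
to `Φ`: its convergents tend to `Φ` for the `q`-adic topology. -/
def ConvergesTo {F : Type*} [Field F] (g : GenContFract (LaurentSeries F))
    (Φ : LaurentSeries F) : Prop :=
  Tendsto (fun i : ℕ => g.convs.get i) atTop (𝓝 Φ)

/-- The `2`-periodic continued fraction
`[n]_q + q ^ n / ([n]_{q⁻¹} + q ^ (-n) / ([n]_q + q ^ n / ([n]_{q⁻¹} + ⋯)))`. -/
def metallicCF (n : ℕ) : GenContFract (LaurentSeries ℚ) where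
  h := qInt (q ℚ) n
  s := Stream'.Seq.ofStream (Stream'.cycle
    [⟨q ℚ ^ (n : ℤ), qInt (q ℚ)⁻¹ n⟩, ⟨q ℚ ^ (-(n : ℤ)), qInt (q ℚ) n⟩]
    (List.cons_ne_nil _ _))

/-- The `q`-deformed metallic number `Φ_n`, the value of the continued fraction `metallicCF n`. -/
def Phi (n : ℕ) : LaurentSeries ℚ :=
  limUnder atTop (fun i : ℕ => (metallicCF n).convs.get i)

/-- A (finite or infinite) continued fraction is a Hankel continued fraction (`H`-fraction) if it
has the form
`v₀ q ^ k₀ / (1 + q u₁) + -v₁ q ^ (k₀ + k₁ + 2) / (1 + q u₂) + -v₂ q ^ (k₁ + k₂ + 2) / (1 + q u₃) + ⋯`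
with nonzero scalars `vⱼ`, natural numbers `kⱼ` and polynomials `uⱼ` in `q` such that
`deg u_{j+1} ≤ kⱼ`. -/
def IsHFraction {F : Type*} [Field F] (g : GenContFract (LaurentSeries F)) : Prop :=
  g.h = 0 ∧
  ∃ (v : ℕ → F) (k : ℕ → ℕ) (u : ℕ → Polynomial F),
    (∀ j, v j ≠ 0) ∧
    (∀ j, (u (j + 1)).natDegree ≤ k j) ∧
    (∀ p, g.s.get? 0 = some p →
      p.a = HahnSeries.C (v 0) * q F ^ k 0 ∧
      p.b = 1 + q F * ((u 1 : PowerSeries F) : LaurentSeries F)) ∧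
    (∀ j p, g.s.get? (j + 1) = some p →
      p.a = -HahnSeries.C (v (j + 1)) * q F ^ (k j + k (j + 1) + 2) ∧
      p.b = 1 + q F * ((u (j + 2) : PowerSeries F) : LaurentSeries F))

/-- The block `U_n`, as a list of pairs (partial numerator, partial denominator). -/
def blockU (n : ℕ) : List (GenContFract.Pair (LaurentSeries ℚ)) :=
  ((List.range (n - 2)).flatMap fun i =>
    [⟨q ℚ ^ (n - i), qInt (q ℚ) (n - i)⟩,
     ⟨q ℚ ^ n, qInt (q ℚ) (i + 2) - q ℚ⟩,
     ⟨q ℚ ^ (i + 2), 1 - q ℚ⟩]) ++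
  [⟨q ℚ ^ 2, qInt (q ℚ) 2⟩, ⟨q ℚ ^ n, qInt (q ℚ) n - q ℚ⟩, ⟨q ℚ ^ n, 1⟩]

/-- The block `V_n`. -/
def blockV (n : ℕ) : List (GenContFract.Pair (LaurentSeries ℚ)) :=
  [⟨-q ℚ ^ (n + 1), qAngle (q ℚ) n + q ℚ ^ (n + 1)⟩,
   ⟨q ℚ ^ (2 * n + 1), qAngle (q ℚ) n⟩,
   ⟨q ℚ ^ (2 * n + 1), qAngle (q ℚ) n + q ℚ ^ (n + 1)⟩,
   ⟨-q ℚ ^ (n + 1), 1⟩]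

/-- The block `W_n`. -/
def blockW (n : ℕ) : List (GenContFract.Pair (LaurentSeries ℚ)) :=
  ((List.range (n - 2)).flatMap fun i =>
    [⟨q ℚ ^ (n - i), qInt (q ℚ) (n - i) - q ℚ⟩,
     ⟨q ℚ ^ n, qInt (q ℚ) (i + 2)⟩,
     ⟨q ℚ ^ (i + 2), 1 - q ℚ⟩]) ++
  [⟨q ℚ ^ 2, 1⟩]

/-- The periodic continued fraction `1 / (1 - q) + (U_n + V_n + W_n +)^*`: the partial quotient
`1 / (1 - q)` is followed by the block `U_n, V_n, W_n` repeated indefinitely. -/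
def hankelCF (n : ℕ) : GenContFract (LaurentSeries ℚ) where
  h := 0
  s := Stream'.Seq.ofStream (Stream'.cons ⟨1, 1 - q ℚ⟩
    (Stream'.cycle (blockU n ++ blockV n ++ blockW n) (by simp [blockV])))

end QMetallic

end

/-! Two levels of the defining fraction combine into a Möbius map with power series coefficients
that contracts the `q`-adic unit ball (`valuation_metallicMap_sub`). Hence the fraction converges,
its value Φ is the fixed point, and ψ = 1/Φ satisfies ψ² = q + Bψ with B = `remB` (`inv_Phi_sq`).

The explicit expansion is then checked as in Lagrange's theory of quadratic irrationals. Each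
complete quotient inside the period is written (ψ + s)/t with s, t rational in q. A partial quotient
a/b leads from (ψ + s')/t' to (ψ + s)/t as soon as s + s' + bt' = -B and att' = q - s(s + B)
(`evalList_cons_mul_eq`). One whole period sends y = ψ + q - 1 to itself (`evalList_period`), and Φ
= 1/(1 - q + y). Being a formal fixed point is not yet being a limit: convergence follows because
the periodic numerators are divisible by q and the denominators are units, so each level shrinks the
truncation error by a factor v(q) or better (`valuation_convs'Aux_sub_le`).

For uniqueness, the order of the value determines the first exponent k. The tail has order at least
k + 2, while 1 + qu has degree at most k + 1, so the tail cannot interfere with reading off the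
first partial quotient (`head_unique`). The tails then have equal values, and induction finishes. -/

namespace QMetallic

open GenContFract

/-! ### The `q`-adic valuation and limits. -/

section Valuation

variable {F : Type*} [Field F]

local notation "v" => (Valued.v : Valuation (LaurentSeries F) (WithZero (Multiplicative ℤ)))

theorem valuation_q_pow (n : ℕ) : v (q F ^ n) = WithZero.exp (-(n : ℤ)) := by
  rw [q, HahnSeries.single_pow, one_pow, nsmul_one, LaurentSeries.valuation_single_zpow]

theorem valuation_q : v (q F) = WithZero.exp (-1 : ℤ) := by
  simpa using valuation_q_pow (F := F) 1

theorem valuation_q_lt_one : v (q F) < 1 := by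
  rw [valuation_q, ← WithZero.exp_zero, WithZero.exp_lt_exp]; norm_num

theorem q_ne_zero : q F ≠ 0 := by
  simp [q]

theorem valuation_coe_le_one (f : PowerSeries F) : v (f : LaurentSeries F) ≤ 1 :=
  (LaurentSeries.val_le_one_iff_eq_coe F _).2 ⟨f, rfl⟩

theorem valuation_C {c : F} (hc : c ≠ 0) : v (HahnSeries.C c) = 1 := by
  have h : ∀ c : F, v (HahnSeries.C c) ≤ 1 := fun c => by
    rw [← PowerSeries.coe_C]; exact valuation_coe_le_one _
  refine le_antisymm (h c) ?_
  have h1 : v (HahnSeries.C c) * v (HahnSeries.C c⁻¹) = 1 := by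
    rw [← map_mul, ← map_mul, mul_inv_cancel₀ hc, map_one, map_one]
  calc (1 : WithZero (Multiplicative ℤ)) = v (HahnSeries.C c) * v (HahnSeries.C c⁻¹) := h1.symm
    _ ≤ v (HahnSeries.C c) * 1 := by gcongr; exact h _
    _ = _ := mul_one _

theorem valuation_one_add_q_mul {t : LaurentSeries F} (ht : v t ≤ 1) : v (1 + q F * t) = 1 := by
  apply Valuation.map_one_add_of_lt
  rw [map_mul]
  exact (mul_le_of_le_one_right' ht).trans_lt valuation_q_lt_one

theorem valuation_add_eq_one {b t : LaurentSeries F} (hb : v b = 1) (ht : v t ≤ v (q F)) :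
    v (b + t) = 1 := by
  rw [Valuation.map_add_eq_of_lt_left _ (by rw [hb]; exact ht.trans_lt valuation_q_lt_one), hb]

theorem tendsto_of_valuation_sub_le {x : ℕ → LaurentSeries F} {a : LaurentSeries F}
    (h : ∀ m, v (x m - a) ≤ v (q F) ^ m) : Tendsto x atTop (𝓝 a) := by
  rw [tendsto_sub_nhds_zero_iff.symm, (Valued.hasBasis_nhds_zero _ _).tendsto_right_iff]
  intro γ _
  -- Basic neighbourhoods are indexed by the value group of the valuation itself; its embedding
  -- makes γ comparable with powers of v(q).
  obtain ⟨N, hN⟩ : ∃ N, v (q F) ^ N < MonoidWithZeroHom.ValueGroup₀.embedding γ.1 := by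
    apply exists_pow_lt₀ valuation_q_lt_one
      (Units.mk0 (MonoidWithZeroHom.ValueGroup₀.embedding γ.1) _)
    simp
  filter_upwards [eventually_ge_atTop N] with m hm
  rw [← MonoidWithZeroHom.ValueGroup₀.embedding_strictMono.lt_iff_lt]
  refine lt_of_le_of_lt ?_ hN
  refine le_trans ?_ ((h m).trans (pow_le_pow_right_of_le_one' valuation_q_lt_one.le hm))
  simp

theorem eventually_valuation_sub_le {ι : Type*} {l : Filter ι} {x : ι → LaurentSeries F}
    {a : LaurentSeries F} (h : Tendsto x l (𝓝 a)) (N : ℕ) :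
    ∀ᶠ i in l, v (x i - a) ≤ v (q F) ^ N := by
  have hq : v (q F ^ N) ≠ 0 := by simp [q_ne_zero]
  -- The valuation is locally constant only away from 0, so the null sequence is translated by `q F
  -- ^ N`.
  have h1 : Tendsto (fun i => x i - a + q F ^ N) l (𝓝 (q F ^ N)) := by
    simpa using (h.sub_const a).add_const (q F ^ N)
  filter_upwards [h1 (Valued.locally_const hq)] with i hi
  have : x i - a = x i - a + q F ^ N - q F ^ N := by ring
  rw [this, ← map_pow]
  exact Valuation.map_sub_le _ (le_of_eq hi) le_rfl

theorem valuation_eq_of_tendsto {ι : Type*} {l : Filter ι} [l.NeBot] {x : ι → LaurentSeries F}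
    {a : LaurentSeries F} (h : Tendsto x l (𝓝 a)) {N : ℕ} (hx : ∀ i, v (x i) = v (q F) ^ N) :
    v a = v (q F) ^ N := by
  obtain ⟨i, hi⟩ := (eventually_valuation_sub_le h (N + 1)).exists
  rw [← hx i]
  apply Valuation.map_eq_of_sub_lt
  rw [Valuation.map_sub_swap, hx]
  refine hi.trans_lt ?_
  rw [← map_pow, ← map_pow, valuation_q_pow, valuation_q_pow, WithZero.exp_lt_exp]
  push_cast; linarith

theorem valuation_le_of_tendsto {ι : Type*} {l : Filter ι} [l.NeBot] {x : ι → LaurentSeries F}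
    {a : LaurentSeries F} (h : Tendsto x l (𝓝 a)) {N : ℕ} (hx : ∀ i, v (x i) ≤ v (q F) ^ N) :
    v a ≤ v (q F) ^ N := by
  obtain ⟨i, hi⟩ := (eventually_valuation_sub_le h N).exists
  have : a = x i - (x i - a) := by ring
  rw [this]
  exact Valuation.map_sub_le _ (hx i) hi

/-- The difference is a(y - x)/((b + x)(b + y)), and both factors below are units. This is the
contraction behind the convergence of the `H`-fraction. -/
theorem valuation_div_add_sub_div_add {a b x y : LaurentSeries F} (hb : v b = 1)
    (hx : v x ≤ v (q F)) (hy : v y ≤ v (q F)) :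
    v (a / (b + x) - a / (b + y)) = v a * v (x - y) := by
  have h1 := valuation_add_eq_one hb hx
  have h2 := valuation_add_eq_one hb hy
  have h3 : b + x ≠ 0 := by rintro h; simp [h] at h1
  have h4 : b + y ≠ 0 := by rintro h; simp [h] at h2
  rw [div_sub_div _ _ h3 h4, map_div₀, map_mul, h1, h2, Valuation.map_sub_swap _ x y, ← map_mul]
  simp only [mul_one, div_one]
  congr 1; ring

end Valuation

/-! ### Recurrence convergents versus nested evaluation. -/

section Convergents

/-- The continuants grow at the far end by a three-term linear recurrence. Both sides obey the same
recurrence, so agreement at the start propagates, and the first partial quotient can be peeled off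
instead. -/
theorem contsAux_cons {K : Type*} [Field K] (h : K) (s : Stream'.Seq (Pair K)) (p : Pair K)
    (hp : s.get? 0 = some p) (m : ℕ) :
    contsAux ⟨h, s⟩ (m + 1) =
      ⟨h * (contsAux ⟨p.b, s.tail⟩ m).a + p.a * (contsAux ⟨p.b, s.tail⟩ m).b,
        (contsAux ⟨p.b, s.tail⟩ m).a⟩ := by
  induction m using Nat.strong_induction_on with
  | _ m ih =>
    match m with
    | 0 => simp [contsAux]
    | 1 => simp [contsAux, hp, nextConts, nextNum, nextDen]; ring
    | m + 2 =>
      have h1 := ih m (by omega)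
      have h2 := ih (m + 1) (by omega)
      cases hs : s.get? (m + 1) with
      | none =>
        have hs' : s.tail.get? m = none := by rw [Stream'.Seq.get?_tail, hs]
        have e1 : contsAux ⟨h, s⟩ (m + 2 + 1) = contsAux ⟨h, s⟩ (m + 1 + 1) :=
          contsAux_stable_step_of_terminated hs
        have e2 : contsAux ⟨p.b, s.tail⟩ (m + 2) = contsAux ⟨p.b, s.tail⟩ (m + 1) :=
          contsAux_stable_step_of_terminated hs'
        rw [e1, e2, h2]
      | some r =>
        have hs' : s.tail.get? m = some r := by rw [Stream'.Seq.get?_tail, hs]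
        rw [contsAux_recurrence (g := ⟨h, s⟩) hs h1 h2,
          contsAux_recurrence (g := ⟨p.b, s.tail⟩) hs' rfl rfl]
        congr 1; ring

theorem convs_cons_succ {K : Type*} [Field K] (h : K) (s : Stream'.Seq (Pair K)) (p : Pair K)
    (hp : s.get? 0 = some p) (m : ℕ) (h0 : convs ⟨p.b, s.tail⟩ m ≠ 0) :
    convs ⟨h, s⟩ (m + 1) = h + p.a / convs ⟨p.b, s.tail⟩ m := by
  rw [conv_eq_conts_a_div_conts_b, nth_cont_eq_succ_nth_contAux] at h0 ⊢
  rw [conv_eq_conts_a_div_conts_b, nth_cont_eq_succ_nth_contAux, contsAux_cons h s p hp]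
  -- Since x/0 = 0, a nonzero convergent has both numerator and denominator nonzero.
  have ha := (div_ne_zero_iff.1 h0).1
  have hb := (div_ne_zero_iff.1 h0).2
  simp only
  field_simp

theorem contsAux_nil {K : Type*} [Field K] (h : K) (s : Stream'.Seq (Pair K))
    (hs : s = Stream'.Seq.nil) (m : ℕ) : contsAux ⟨h, s⟩ (m + 1) = ⟨h, 1⟩ := by
  induction m with
  | zero => rfl
  | succ m ih => rw [contsAux.eq_3]; simpa [hs] using ih

theorem convs_nil {K : Type*} [Field K] (h : K) (s : Stream'.Seq (Pair K))
    (hs : s = Stream'.Seq.nil) (m : ℕ) : convs ⟨h, s⟩ m = h := by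
  rw [conv_eq_conts_a_div_conts_b, nth_cont_eq_succ_nth_contAux, contsAux_nil h s hs]
  simp

variable {F : Type*} [Field F]

local notation "v" => (Valued.v : Valuation (LaurentSeries F) (WithZero (Multiplicative ℤ)))

/-- A sequence of partial quotients whose numerators are divisible by `q` and whose denominators
are units of the ring of formal power series. -/
def IsContracting (s : Stream'.Seq (Pair (LaurentSeries F))) : Prop :=
  ∀ j p, s.get? j = some p → v p.a ≤ v (q F) ∧ v p.b = 1

theorem IsContracting.tail {s : Stream'.Seq (Pair (LaurentSeries F))} (hs : IsContracting s) :
    IsContracting s.tail := fun j p hp => hs (j + 1) p (by rwa [Stream'.Seq.get?_tail] at hp)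

theorem valuation_div_add {a b t : LaurentSeries F} (hb : v b = 1) (ht : v t ≤ v (q F)) :
    v (a / (b + t)) = v a := by
  rw [map_div₀, valuation_add_eq_one hb ht, div_one]

theorem valuation_convs'Aux_le {s : Stream'.Seq (Pair (LaurentSeries F))} (hs : IsContracting s)
    (m : ℕ) : v (convs'Aux s m) ≤ v (q F) := by
  induction m generalizing s with
  | zero => simp [convs'Aux]
  | succ m ih =>
    cases h : s.head with
    | none => rw [convs'Aux_succ_none h]; simp
    | some p =>
      rw [convs'Aux_succ_some h, valuation_div_add (hs 0 p h).2 (ih hs.tail)]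
      exact (hs 0 p h).1

theorem convs_eq_add_convs'Aux {s : Stream'.Seq (Pair (LaurentSeries F))} (hs : IsContracting s)
    {b : LaurentSeries F} (hb : v b = 1) (m : ℕ) :
    convs ⟨b, s⟩ m = b + convs'Aux s m := by
  induction m generalizing s b with
  | zero => simp [convs'Aux, zeroth_conv_eq_h]
  | succ m ih =>
    cases h : s.head with
    | none =>
      rw [convs'Aux_succ_none h, add_zero, convs_nil _ _ (Stream'.Seq.get?_zero_eq_none.1 h)]
    | some p =>
      have h1 := ih hs.tail (hs 0 p h).2
      have h2 : convs ⟨p.b, s.tail⟩ m ≠ 0 := by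
        rw [h1]
        intro h0
        have := valuation_add_eq_one (hs 0 p h).2 (valuation_convs'Aux_le hs.tail m)
        simp [h0] at this
      rw [convs'Aux_succ_some h, convs_cons_succ b s p h m h2, h1]

/-- Only the tail is required to contract, because the first numerator of an `H`-fraction may be a
unit. -/
theorem convs_zero_eq_convs'Aux {s : Stream'.Seq (Pair (LaurentSeries F))}
    (hs : IsContracting s.tail) (hb : ∀ p, s.get? 0 = some p → v p.b = 1) (m : ℕ) :
    convs ⟨0, s⟩ m = convs'Aux s m := by
  cases m with
  | zero => simp [convs'Aux, zeroth_conv_eq_h]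
  | succ m =>
    cases h : s.head with
    | none =>
      rw [convs'Aux_succ_none h, convs_nil _ _ (Stream'.Seq.get?_zero_eq_none.1 h)]
    | some p =>
      have h1 := convs_eq_add_convs'Aux hs (hb p h) m
      have h2 : convs ⟨p.b, s.tail⟩ m ≠ 0 := by
        rw [h1]
        intro h0
        have := valuation_add_eq_one (hb p h) (valuation_convs'Aux_le hs m)
        simp [h0] at this
      rw [convs'Aux_succ_some h, convs_cons_succ 0 s p h m h2, h1, zero_add]

end Convergents

/-! ### `q`-integers. -/

section QInt

theorem qInt_succ {R : Type*} [CommRing R] (x : R) (m : ℕ) : qInt x (m + 1) = 1 + x * qInt x m := by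
  rw [qInt, Finset.sum_range_succ', qInt, Finset.mul_sum, pow_zero, add_comm]
  simp_rw [pow_succ']

theorem qInt_succ' {R : Type*} [CommRing R] (x : R) (m : ℕ) : qInt x (m + 1) = qInt x m + x ^ m :=
  Finset.sum_range_succ _ _

theorem one_sub_mul_qInt {R : Type*} [CommRing R] (x : R) (m : ℕ) :
    (1 - x) * qInt x m = 1 - x ^ m := mul_neg_geom_sum x m

theorem pow_mul_qInt_inv {K : Type*} [Field K] {x : K} (hx : x ≠ 0) (m : ℕ) :
    x ^ m * qInt x⁻¹ m = x * qInt x m := by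
  induction m with
  | zero => simp [qInt]
  | succ m ih =>
    rw [qInt_succ' x⁻¹, mul_add, pow_succ', mul_assoc, ih, inv_pow, qInt_succ]
    field_simp
    ring

variable {F : Type*} [Field F]

local notation "v" => (Valued.v : Valuation (LaurentSeries F) (WithZero (Multiplicative ℤ)))

theorem valuation_q_pow_le_one (m : ℕ) : v (q F ^ m) ≤ 1 := by
  rw [map_pow]; exact pow_le_one' valuation_q_lt_one.le _

theorem valuation_qInt_le_one (m : ℕ) : v (qInt (q F) m) ≤ 1 :=
  Valuation.map_sum_le _ fun i _ => valuation_q_pow_le_one i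

theorem valuation_qInt {m : ℕ} (hm : 1 ≤ m) : v (qInt (q F) m) = 1 := by
  obtain ⟨m, rfl⟩ := Nat.exists_eq_add_of_le' hm
  rw [qInt_succ]
  exact valuation_one_add_q_mul (valuation_qInt_le_one m)

theorem one_sub_q_ne_zero : 1 - q F ≠ 0 := by
  intro h
  have := (Valued.v : Valuation (LaurentSeries F) _).map_one_sub_of_lt valuation_q_lt_one
  simp [h] at this

end QInt

/-- Valuation balls are open subgroups. This allows the Cauchy property to be tested on consecutive
differences. -/
theorem nonarchimedeanAddGroup_laurentSeries (F : Type*) [Field F] :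
    NonarchimedeanAddGroup (LaurentSeries F) where
  is_nonarchimedean U hU := by
    obtain ⟨γ, hγ⟩ := Valued.mem_nhds_zero.1 hU
    exact ⟨⟨Valued.v.restrict.ltAddSubgroup γ, Valued.isOpen_ball _ _⟩, hγ⟩

/-! ### Convergence of the metallic fraction and its quadratic equation. -/

section Metallic

local notation "v" => (Valued.v : Valuation (LaurentSeries ℚ) (WithZero (Multiplicative ℤ)))

local notation "𝐪" => q ℚ

/-- The map `x ↦ [n]_q + q ^ n / ([n]_{q⁻¹} + q ^ (-n) / x)`, after clearing denominators. -/
noncomputable def metallicMap (n : ℕ) (x : LaurentSeries ℚ) : LaurentSeries ℚ :=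
  qInt 𝐪 n + 𝐪 ^ (2 * n) * x / (1 + 𝐪 * (qInt 𝐪 n * x))

variable {n : ℕ}

theorem valuation_metallicMap_den {x : LaurentSeries ℚ} (hx : v x ≤ 1) :
    v (1 + 𝐪 * (qInt 𝐪 n * x)) = 1 := by
  apply valuation_one_add_q_mul
  rw [map_mul]
  exact mul_le_one' (valuation_qInt_le_one n) hx

theorem metallicMap_den_ne_zero {x : LaurentSeries ℚ} (hx : v x ≤ 1) :
    1 + 𝐪 * (qInt 𝐪 n * x) ≠ 0 := by
  intro h
  have := valuation_metallicMap_den (n := n) hx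
  simp [h] at this

theorem valuation_metallicMap (hn : 1 ≤ n) {x : LaurentSeries ℚ} (hx : v x ≤ 1) :
    v (metallicMap n x) = 1 := by
  apply valuation_add_eq_one (valuation_qInt hn)
  rw [map_div₀, valuation_metallicMap_den hx, div_one, map_mul,
    show 2 * n = 1 + (2 * n - 1) by omega, pow_add, pow_one, map_mul]
  calc _ ≤ v 𝐪 * 1 * 1 := by gcongr; exact valuation_q_pow_le_one _
    _ = _ := by simp

/-- The map is Möbius with determinant `𝐪 ^ (2 * n)`, and its denominators are units at integral
arguments. -/
theorem valuation_metallicMap_sub {x y : LaurentSeries ℚ} (hx : v x ≤ 1) (hy : v y ≤ 1) :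
    v (metallicMap n x - metallicMap n y) = v 𝐪 ^ (2 * n) * v (x - y) := by
  have h1 := metallicMap_den_ne_zero (n := n) hx
  have h2 := metallicMap_den_ne_zero (n := n) hy
  have : metallicMap n x - metallicMap n y = 𝐪 ^ (2 * n) * (x - y) /
      ((1 + 𝐪 * (qInt 𝐪 n * x)) * (1 + 𝐪 * (qInt 𝐪 n * y))) := by
    rw [metallicMap, metallicMap, add_sub_add_left_eq_sub, div_sub_div _ _ h1 h2]
    congr 1; ring
  rw [this, map_div₀, map_mul, map_mul, map_pow, valuation_metallicMap_den hx,
    valuation_metallicMap_den hy]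
  simp

theorem metallicCF_tail (n : ℕ) : (metallicCF n).s.tail.tail = (metallicCF n).s := by
  conv_lhs => rw [metallicCF]
  simp only
  rw [Stream'.cycle_eq, Stream'.cons_append_stream, Stream'.cons_append_stream,
    Stream'.nil_append_stream, Stream'.Seq.ofStream_cons, Stream'.Seq.ofStream_cons,
    Stream'.Seq.tail_cons, Stream'.Seq.tail_cons]
  rfl

/-- The numerators `𝐪 ^ (-n)` rule out a contraction argument level by level; taking two levels
together removes the negative powers. -/
theorem metallicCF_convs_add_two {m : ℕ} (h : v ((metallicCF n).convs m) ≤ 1)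
    (h0 : (metallicCF n).convs m ≠ 0) :
    (metallicCF n).convs (m + 2) = metallicMap n ((metallicCF n).convs m) := by
  have hq : 𝐪 ^ n ≠ 0 := pow_ne_zero _ q_ne_zero
  have e : (⟨qInt 𝐪 n, (metallicCF n).s.tail.tail⟩ : GenContFract (LaurentSeries ℚ))
      = metallicCF n := by
    rw [metallicCF_tail]; rfl
  have h1 : convs ⟨qInt 𝐪⁻¹ n, (metallicCF n).s.tail⟩ (m + 1)
      = qInt 𝐪⁻¹ n + 𝐪 ^ (-(n : ℤ)) / (metallicCF n).convs m := by
    have := convs_cons_succ (qInt 𝐪⁻¹ n) (metallicCF n).s.tail ⟨𝐪 ^ (-(n : ℤ)), qInt 𝐪 n⟩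
      (by rw [Stream'.Seq.get?_tail]; rfl) m
    simp only [e] at this
    exact this h0
  set x := (metallicCF n).convs m
  have h2 : qInt 𝐪⁻¹ n + 𝐪 ^ (-(n : ℤ)) / x = (1 + 𝐪 * (qInt 𝐪 n * x)) / (𝐪 ^ n * x) := by
    rw [zpow_neg, zpow_natCast, eq_div_iff (mul_ne_zero hq h0)]
    have := pow_mul_qInt_inv (q_ne_zero (F := ℚ)) n
    rw [add_mul, mul_left_comm, ← mul_assoc (𝐪 ^ n), this, div_mul_eq_mul_div,
      inv_mul_cancel_left₀ hq, div_self h0]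
    ring
  have h3 := metallicMap_den_ne_zero (n := n) h
  have h4 := convs_cons_succ (qInt 𝐪 n) (metallicCF n).s ⟨𝐪 ^ (n : ℤ), qInt 𝐪⁻¹ n⟩ rfl (m + 1)
    (by rw [h1, h2]; exact div_ne_zero h3 (mul_ne_zero hq h0))
  refine h4.trans ?_
  simp only
  rw [h1, h2, metallicMap, zpow_natCast, two_mul n, pow_add]
  field_simp

theorem metallicCF_convs_zero (n : ℕ) : (metallicCF n).convs 0 = qInt 𝐪 n := zeroth_conv_eq_h

theorem metallicCF_convs_one (hn : 1 ≤ n) :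
    (metallicCF n).convs 1 = qInt 𝐪 n + 𝐪 ^ (2 * n - 1) / qInt 𝐪 n := by
  have h0 : qInt 𝐪 n ≠ 0 := by
    intro h; have := valuation_qInt (F := ℚ) hn; simp [h] at this
  have hq := q_ne_zero (F := ℚ)
  have h1 := pow_mul_qInt_inv hq n
  have h2 : qInt 𝐪⁻¹ n ≠ 0 := by
    intro h; rw [h, mul_zero] at h1; exact mul_ne_zero hq h0 h1.symm
  have h3 : convs ⟨qInt 𝐪⁻¹ n, (metallicCF n).s.tail⟩ 0 = qInt 𝐪⁻¹ n := zeroth_conv_eq_h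
  have h4 := convs_cons_succ (qInt 𝐪 n) (metallicCF n).s ⟨𝐪 ^ (n : ℤ), qInt 𝐪⁻¹ n⟩ rfl 0
    (by rw [h3]; exact h2)
  refine h4.trans ?_
  simp only
  rw [h3, zpow_natCast]
  congr 1
  rw [div_eq_div_iff h2 h0]
  obtain ⟨m, rfl⟩ := Nat.exists_eq_add_of_le' hn
  rw [show 2 * (m + 1) - 1 = m + (m + 1) by omega, pow_add 𝐪 m (m + 1), mul_assoc, h1]
  ring

theorem valuation_metallicCF_convs (hn : 1 ≤ n) (m : ℕ) : v ((metallicCF n).convs m) = 1 := by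
  induction m using Nat.strong_induction_on with
  | _ m ih =>
    match m with
    | 0 => rw [metallicCF_convs_zero, valuation_qInt hn]
    | 1 =>
      rw [metallicCF_convs_one hn]
      apply valuation_add_eq_one (valuation_qInt hn)
      rw [map_div₀, valuation_qInt hn, div_one, show 2 * n - 1 = 1 + (2 * n - 2) by omega, pow_add,
        map_mul, pow_one]
      exact mul_le_of_le_one_right' (valuation_q_pow_le_one _)
    | m + 2 =>
      have h := ih m (by omega)
      rw [metallicCF_convs_add_two h.le (by intro h0; simp [h0] at h)]
      exact valuation_metallicMap hn h.le

theorem metallicCF_convs_succ_succ (hn : 1 ≤ n) (m : ℕ) :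
    (metallicCF n).convs (m + 2) = metallicMap n ((metallicCF n).convs m) := by
  have h := valuation_metallicCF_convs hn m
  exact metallicCF_convs_add_two h.le (by intro h0; simp [h0] at h)

/-- The contraction advances two indices at a time, so even and odd indices each need a base case.
-/
theorem valuation_metallicCF_convs_sub_le (hn : 1 ≤ n) (m : ℕ) :
    v ((metallicCF n).convs (m + 1) - (metallicCF n).convs m) ≤ v 𝐪 ^ m := by
  induction m using Nat.strong_induction_on with
  | _ m ih =>
    match m with
    | 0 =>
      rw [pow_zero]
      exact Valuation.map_sub_le _ (valuation_metallicCF_convs hn _).le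
        (valuation_metallicCF_convs hn _).le
    | 1 =>
      rw [metallicCF_convs_succ_succ hn 0, metallicCF_convs_one hn, metallicMap,
        metallicCF_convs_zero, add_sub_add_left_eq_sub, pow_one]
      have h := valuation_qInt (F := ℚ) hn
      apply Valuation.map_sub_le
      · rw [map_div₀, valuation_metallicMap_den h.le, map_mul, h,
          show 2 * n = 1 + (2 * n - 1) by omega, pow_add, map_mul, pow_one, mul_one, div_one]
        exact mul_le_of_le_one_right' (valuation_q_pow_le_one _)
      · rw [map_div₀, h, div_one, show 2 * n - 1 = 1 + (2 * n - 2) by omega, pow_add,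
          map_mul, pow_one]
        exact mul_le_of_le_one_right' (valuation_q_pow_le_one _)
    | m + 2 =>
      rw [metallicCF_convs_succ_succ hn (m + 1), metallicCF_convs_succ_succ hn m,
        valuation_metallicMap_sub (valuation_metallicCF_convs hn _).le
          (valuation_metallicCF_convs hn _).le, add_comm m 2, pow_add]
      exact mul_le_mul' (pow_le_pow_right_of_le_one' (valuation_q_lt_one (F := ℚ)).le (by omega))
        (ih m (by omega))

theorem convergesTo_metallicCF (hn : 1 ≤ n) : ConvergesTo (metallicCF n) (Phi n) := by
  have : CauchySeq (fun i : ℕ => (metallicCF n).convs.get i) := by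
    have := nonarchimedeanAddGroup_laurentSeries ℚ
    apply NonarchimedeanAddGroup.cauchySeq_of_tendsto_sub_nhds_zero
    apply tendsto_of_valuation_sub_le
    intro m
    rw [sub_zero]
    exact valuation_metallicCF_convs_sub_le hn m
  exact this.tendsto_limUnder

theorem valuation_Phi (hn : 1 ≤ n) : v (Phi n) = 1 := by
  have := valuation_eq_of_tendsto (convergesTo_metallicCF hn) (N := 0) fun i => by
    rw [pow_zero]; exact valuation_metallicCF_convs hn i
  simpa using this

theorem metallicMap_Phi (hn : 1 ≤ n) : metallicMap n (Phi n) = Phi n := by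
  have h := convergesTo_metallicCF hn
  have h0 := metallicMap_den_ne_zero (n := n) (valuation_Phi hn).le
  have h1 : Tendsto (fun i : ℕ => metallicMap n ((metallicCF n).convs.get i)) atTop
      (𝓝 (metallicMap n (Phi n))) :=
    ((h.const_mul _).div (((h.const_mul _).const_mul _).const_add _) h0).const_add _
  refine tendsto_nhds_unique (h1.congr fun i => ?_) (h.comp (tendsto_add_atTop_nat 2))
  exact (metallicCF_convs_succ_succ hn i).symm

/-- The quadratic equation of the `q`-deformed metallic number. -/
theorem Phi_quadratic (hn : 1 ≤ n) :
    𝐪 * Phi n ^ 2 + (qAngle 𝐪 n - 2 * 𝐪 * qInt 𝐪 n) * Phi n = 1 := by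
  have h := metallicMap_Phi hn
  have h0 := metallicMap_den_ne_zero (n := n) (valuation_Phi hn).le
  have h1 : qInt 𝐪 n ≠ 0 := by
    intro h; have := valuation_qInt (F := ℚ) hn; simp [h] at this
  have h2 := one_sub_mul_qInt 𝐪 n
  rw [metallicMap] at h
  rw [← eq_sub_iff_add_eq', div_eq_iff h0] at h
  -- The fixed-point equation is `qInt 𝐪 n` times the desired one, since 1 - q²ⁿ = (1 + qⁿ)(1 -
  -- q)[n].
  apply mul_left_cancel₀ h1
  rw [qAngle]
  linear_combination -h + (1 + 𝐪 ^ n) * Phi n * h2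

end Metallic

/-! ### The explicit fraction has Hankel form. -/

section Chain

local notation "v" => (Valued.v : Valuation (LaurentSeries ℚ) (WithZero (Multiplicative ℤ)))

local notation "𝐪" => q ℚ

/-- A polynomial in `q`, as a formal Laurent series. -/
noncomputable def polyToLaurent : Polynomial ℚ →+* LaurentSeries ℚ :=
  (HahnSeries.ofPowerSeries ℤ ℚ).comp Polynomial.coeToPowerSeries.ringHom

@[simp] theorem polyToLaurent_X : polyToLaurent Polynomial.X = 𝐪 := by
  simp [polyToLaurent, q]

theorem polyToLaurent_qInt (m : ℕ) : polyToLaurent (qInt Polynomial.X m) = qInt 𝐪 m := by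
  simp [qInt]

theorem natDegree_qInt_succ_le (m : ℕ) :
    (qInt (Polynomial.X : Polynomial ℚ) (m + 1)).natDegree ≤ m := by
  apply Polynomial.natDegree_sum_le_of_forall_le
  intro i hi
  rw [Polynomial.natDegree_X_pow]
  have := Finset.mem_range.1 hi
  omega

/-- A partial quotient of a Hankel continued fraction that is preceded by the exponent `k` and
carries the exponent `k'`. -/
def IsHLink (k k' : ℕ) (p : Pair (LaurentSeries ℚ)) : Prop :=
  ∃ (c : ℚ) (u : Polynomial ℚ), c ≠ 0 ∧ u.natDegree ≤ k' ∧
    p.a = -HahnSeries.C c * 𝐪 ^ (k + k' + 2) ∧ p.b = 1 + 𝐪 * polyToLaurent u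

/-- A list of consecutive partial quotients of a Hankel continued fraction that is preceded by the
exponent `k` and ends with the exponent `k'`. -/
def IsHChain : ℕ → List (Pair (LaurentSeries ℚ)) → ℕ → Prop
  | k, [], k' => k = k'
  | k, p :: l, k' => ∃ k₁, IsHLink k k₁ p ∧ IsHChain k₁ l k'

theorem IsHChain.append {k k' k'' : ℕ} {l l' : List (Pair (LaurentSeries ℚ))}
    (h : IsHChain k l k') (h' : IsHChain k' l' k'') : IsHChain k (l ++ l') k'' := by
  induction l generalizing k with
  | nil => cases h; exact h'
  | cons p l ih =>
    obtain ⟨k₁, h1, h2⟩ := h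
    exact ⟨k₁, h1, ih h2⟩

theorem isHChain_flatMap {α : Type*} {f : α → List (Pair (LaurentSeries ℚ))} {k : ℕ} (l : List α)
    (h : ∀ x ∈ l, IsHChain k (f x) k) : IsHChain k (l.flatMap f) k := by
  induction l with
  | nil => rfl
  | cons x l ih =>
    rw [List.flatMap_cons]
    exact (h x (by simp)).append (ih fun y hy => h y (by simp [hy]))

theorem IsHChain.exists_exponents {k k' : ℕ} {l : List (Pair (LaurentSeries ℚ))}
    (h : IsHChain k l k') : ∃ K : ℕ → ℕ, K 0 = k ∧ K l.length = k' ∧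
      ∀ j (hj : j < l.length), IsHLink (K j) (K (j + 1)) l[j] := by
  induction l generalizing k with
  | nil => exact ⟨fun _ => k, rfl, h, fun j hj => by simp at hj⟩
  | cons p l ih =>
    obtain ⟨k₁, h1, h2⟩ := h
    obtain ⟨K, h3, h4, h5⟩ := ih h2
    refine ⟨fun j => Nat.casesOn j k K, rfl, h4, fun j hj => ?_⟩
    cases j with
    | zero => simpa [h3] using h1
    | succ j => exact h5 j (by simpa using hj)

theorem IsHLink.valuation_a {k k' : ℕ} {p : Pair (LaurentSeries ℚ)} (h : IsHLink k k' p) :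
    v p.a ≤ v 𝐪 := by
  obtain ⟨c, u, hc, -, ha, -⟩ := h
  rw [ha, map_mul, Valuation.map_neg, valuation_C hc, one_mul, pow_succ, map_mul]
  exact mul_le_of_le_one_left' (valuation_q_pow_le_one _)

theorem IsHLink.a_ne_zero {k k' : ℕ} {p : Pair (LaurentSeries ℚ)} (h : IsHLink k k' p) :
    p.a ≠ 0 := by
  obtain ⟨c, u, hc, -, ha, -⟩ := h
  rw [ha]
  exact mul_ne_zero (neg_ne_zero.2 ((map_ne_zero HahnSeries.C).2 hc)) (pow_ne_zero _ q_ne_zero)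

theorem IsHLink.valuation_b {k k' : ℕ} {p : Pair (LaurentSeries ℚ)} (h : IsHLink k k' p) :
    v p.b = 1 := by
  obtain ⟨c, u, -, -, -, hb⟩ := h
  rw [hb]
  exact valuation_one_add_q_mul (valuation_coe_le_one _)

theorem isHLink_of_pos {k k' m : ℕ} {b : LaurentSeries ℚ} (u : Polynomial ℚ)
    (hu : u.natDegree ≤ k') (hm : m = k + k' + 2) (hb : b = 1 + 𝐪 * polyToLaurent u) :
    IsHLink k k' ⟨𝐪 ^ m, b⟩ :=
  ⟨-1, u, by norm_num, hu, by simp [hm], hb⟩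

theorem isHLink_of_neg {k k' m : ℕ} {b : LaurentSeries ℚ} (u : Polynomial ℚ)
    (hu : u.natDegree ≤ k') (hm : m = k + k' + 2) (hb : b = 1 + 𝐪 * polyToLaurent u) :
    IsHLink k k' ⟨-𝐪 ^ m, b⟩ :=
  ⟨1, u, one_ne_zero, hu, by simp [hm], hb⟩

theorem isHLink_qInt {k k' m : ℕ} (hm : m = k + k' + 2) :
    IsHLink k k' ⟨𝐪 ^ m, qInt 𝐪 (k' + 2)⟩ :=
  isHLink_of_pos (qInt Polynomial.X (k' + 1)) (natDegree_qInt_succ_le k') hm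
    (by rw [polyToLaurent_qInt, qInt_succ])

theorem isHLink_qInt_sub {k k' m : ℕ} (hm : m = k + k' + 2) :
    IsHLink k k' ⟨𝐪 ^ m, qInt 𝐪 (k' + 2) - 𝐪⟩ := by
  refine isHLink_of_pos (qInt Polynomial.X (k' + 1) - 1) ?_ hm ?_
  · exact (Polynomial.natDegree_sub_le _ _).trans
      (max_le (natDegree_qInt_succ_le k') (by simp))
  · rw [map_sub, polyToLaurent_qInt, qInt_succ, map_one]; ring

theorem isHLink_one_sub {k m : ℕ} (hm : m = k + 2) : IsHLink k 0 ⟨𝐪 ^ m, 1 - 𝐪⟩ :=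
  isHLink_of_pos (-1) (by simp) hm (by simp; ring)

theorem isHLink_one {k m : ℕ} (hm : m = k + 2) : IsHLink k 0 ⟨𝐪 ^ m, 1⟩ :=
  isHLink_of_pos 0 (by simp) hm (by simp)

theorem isHChain_blockU {n : ℕ} (hn : 2 ≤ n) : IsHChain 0 (blockU n) 0 := by
  refine (isHChain_flatMap _ fun i hi => ?_).append ?_
  · obtain ⟨k, rfl⟩ : ∃ k, n = i + k + 2 := by
      have := List.mem_range.1 hi
      exact ⟨n - i - 2, by omega⟩
    rw [show i + k + 2 - i = k + 2 by omega]
    -- Each triple runs through the exponents 0, n - i - 2, i, 0, so triples can be concatenated.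
    exact ⟨k, isHLink_qInt (by omega), i, isHLink_qInt_sub (by omega), 0,
      isHLink_one_sub (by omega), rfl⟩
  · obtain ⟨k, rfl⟩ := Nat.exists_eq_add_of_le' hn
    exact ⟨0, isHLink_qInt (by omega), k, isHLink_qInt_sub (by omega), 0,
      isHLink_one (by omega), rfl⟩

theorem isHChain_blockW {n : ℕ} (hn : 2 ≤ n) : IsHChain 0 (blockW n) 0 := by
  refine (isHChain_flatMap _ fun i hi => ?_).append ?_
  · obtain ⟨k, rfl⟩ : ∃ k, n = i + k + 2 := by
      have := List.mem_range.1 hi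
      exact ⟨n - i - 2, by omega⟩
    rw [show i + k + 2 - i = k + 2 by omega]
    exact ⟨k, isHLink_qInt_sub (by omega), i, isHLink_qInt (by omega), 0,
      isHLink_one_sub (by omega), rfl⟩
  · exact ⟨0, isHLink_one (by omega), rfl⟩

theorem isHChain_blockV {n : ℕ} (hn : 1 ≤ n) : IsHChain 0 (blockV n) 0 := by
  obtain ⟨k, rfl⟩ := Nat.exists_eq_add_of_le' hn
  have h1 : (qInt Polynomial.X (k + 1) - 1 + Polynomial.X ^ k : Polynomial ℚ).natDegree ≤ k := by
    refine (Polynomial.natDegree_add_le _ _).trans (max_le ?_ (by simp))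
    exact (Polynomial.natDegree_sub_le _ _).trans (max_le (natDegree_qInt_succ_le k) (by simp))
  have h2 : (qInt Polynomial.X (k + 1) - 1 + Polynomial.X ^ k - Polynomial.X ^ (k + 1) :
      Polynomial ℚ).natDegree ≤ k + 1 :=
    (Polynomial.natDegree_sub_le _ _).trans (max_le (h1.trans (by omega)) (by simp))
  have e1 : qAngle 𝐪 (k + 1) + 𝐪 ^ (k + 1 + 1) =
      1 + 𝐪 * polyToLaurent (qInt Polynomial.X (k + 1) - 1 + Polynomial.X ^ k) := by
    simp only [map_add, map_sub, map_one, map_pow, polyToLaurent_qInt, polyToLaurent_X, qAngle]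
    ring
  have e2 : qAngle 𝐪 (k + 1) = 1 + 𝐪 * polyToLaurent
      (qInt Polynomial.X (k + 1) - 1 + Polynomial.X ^ k - Polynomial.X ^ (k + 1)) := by
    simp only [map_add, map_sub, map_one, map_pow, polyToLaurent_qInt, polyToLaurent_X, qAngle]
    ring
  -- With n = k + 1, the exponents are 0, n - 1, n, n - 1, 0.
  exact ⟨k, isHLink_of_neg _ h1 (by omega) e1, k + 1, isHLink_of_pos _ h2 (by omega) e2,
    k, isHLink_of_pos _ h1 (by omega) e1, 0, isHLink_of_neg 0 (by simp) (by omega) (by simp), rfl⟩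

/-- The period `U_n, V_n, W_n`. -/
noncomputable def period (n : ℕ) : List (Pair (LaurentSeries ℚ)) :=
  blockU n ++ blockV n ++ blockW n

theorem isHChain_period {n : ℕ} (hn : 2 ≤ n) : IsHChain 0 (period n) 0 :=
  ((isHChain_blockU hn).append (isHChain_blockV (by omega))).append (isHChain_blockW hn)

theorem length_period {n : ℕ} (hn : 2 ≤ n) : (period n).length = 6 * n - 4 := by
  simp [period, blockU, blockV, blockW]
  omega

theorem get_cycle {α : Type*} (l : List α) (hl : l ≠ []) (i : ℕ) :
    (Stream'.cycle l hl).get i = l[i % l.length]'(Nat.mod_lt _ (List.length_pos_of_ne_nil hl)) := by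
  induction i using Nat.strong_induction_on with
  | _ i ih =>
    rw [Stream'.cycle_eq]
    by_cases h : i < l.length
    · rw [Stream'.get_append_left _ _ _ h]
      simp only [Nat.mod_eq_of_lt h]
    · obtain ⟨j, rfl⟩ := Nat.exists_eq_add_of_le (not_lt.1 h)
      have := List.length_pos_of_ne_nil hl
      rw [Stream'.get_append_right, ih j (by omega)]
      simp only [Nat.add_mod_left]

theorem hankelCF_get?_zero (n : ℕ) : (hankelCF n).s.get? 0 = some ⟨1, 1 - 𝐪⟩ := rfl

theorem period_ne_nil (n : ℕ) : period n ≠ [] := by simp [period, blockV]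

theorem hankelCF_get?_succ (n i : ℕ) : (hankelCF n).s.get? (i + 1) =
    some ((period n)[i % (period n).length]'
      (Nat.mod_lt _ (List.length_pos_of_ne_nil (period_ne_nil n)))) := by
  rw [← get_cycle _ (period_ne_nil n)]
  rfl

theorem hankelCF_periodic {n : ℕ} (hn : 2 ≤ n) {i : ℕ} (hi : 1 ≤ i) :
    (hankelCF n).s.get? (i + (6 * n - 4)) = (hankelCF n).s.get? i := by
  obtain ⟨i, rfl⟩ := Nat.exists_eq_add_of_le' hi
  rw [add_right_comm, hankelCF_get?_succ, hankelCF_get?_succ, ← length_period hn]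
  simp only [Nat.add_mod_right]

/-- The period begins and ends with exponent 0, so its exponents extend periodically without a clash
at the seam. -/
theorem exists_exponents_hankelCF {n : ℕ} (hn : 2 ≤ n) : ∃ K : ℕ → ℕ, K 0 = 0 ∧
    ∀ j p, (hankelCF n).s.get? (j + 1) = some p → IsHLink (K j) (K (j + 1)) p := by
  obtain ⟨K, h0, h1, hK⟩ := (isHChain_period hn).exists_exponents
  have hl := List.length_pos_of_ne_nil (period_ne_nil n)
  refine ⟨fun j => K (j % (period n).length), by simpa using h0, fun j p hp => ?_⟩
  rw [hankelCF_get?_succ] at hp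
  cases hp
  have h := hK _ (Nat.mod_lt j hl)
  convert h using 1
  change K ((j + 1) % _) = _
  rw [Nat.add_mod_eq_ite]
  rcases Nat.lt_or_ge 1 (period n).length with h2 | h2
  · rw [Nat.mod_eq_of_lt h2]
    split_ifs with h3
    · have : j % (period n).length + 1 = (period n).length := by
        have := Nat.mod_lt j hl
        omega
      rw [this, h1, Nat.sub_self, h0]
    · rfl
  · rw [length_period hn] at h2; omega

theorem isHFraction_of_isHLink {g : GenContFract (LaurentSeries ℚ)} (hg : g.h = 0) {K : ℕ → ℕ}
    (h0 : ∀ p, g.s.get? 0 = some p → ∃ (c : ℚ) (u : Polynomial ℚ), c ≠ 0 ∧ u.natDegree ≤ K 0 ∧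
      p.a = HahnSeries.C c * 𝐪 ^ K 0 ∧ p.b = 1 + 𝐪 * polyToLaurent u)
    (h : ∀ j p, g.s.get? (j + 1) = some p → IsHLink (K j) (K (j + 1)) p) : IsHFraction g := by
  have H0 : ∃ (c : ℚ) (u : Polynomial ℚ), c ≠ 0 ∧ u.natDegree ≤ K 0 ∧
      ∀ p, g.s.get? 0 = some p →
        p.a = HahnSeries.C c * 𝐪 ^ K 0 ∧ p.b = 1 + 𝐪 * polyToLaurent u := by
    cases hs : g.s.get? 0 with
    -- Past the end of a finite fraction, any admissible data will do.
    | none => exact ⟨1, 0, one_ne_zero, by simp, by simp⟩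
    | some p =>
      obtain ⟨c, u, h1, h2, h3⟩ := h0 p hs
      exact ⟨c, u, h1, h2, fun p hp => Option.some.inj hp ▸ h3⟩
  have H : ∀ j, ∃ (c : ℚ) (u : Polynomial ℚ), c ≠ 0 ∧ u.natDegree ≤ K (j + 1) ∧
      ∀ p, g.s.get? (j + 1) = some p →
        p.a = -HahnSeries.C c * 𝐪 ^ (K j + K (j + 1) + 2) ∧ p.b = 1 + 𝐪 * polyToLaurent u := by
    intro j
    cases hs : g.s.get? (j + 1) with
    | none => exact ⟨1, 0, one_ne_zero, by simp, by simp⟩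
    | some p =>
      obtain ⟨c, u, h1, h2, h3⟩ := h j p hs
      exact ⟨c, u, h1, h2, fun p hp => Option.some.inj hp ▸ h3⟩
  obtain ⟨c₀, u₀, hc₀, hu₀, hp₀⟩ := H0
  choose c u hc hu hp using H
  let c' : ℕ → ℚ := fun j => Nat.casesOn j c₀ c
  let u' : ℕ → Polynomial ℚ := fun j => Nat.casesOn j 0 fun j => Nat.casesOn j u₀ u
  refine ⟨hg, c', K, u', ?_, ?_, hp₀, hp⟩
  · rintro (_ | j)
    · exact hc₀
    · exact hc j
  · rintro (_ | j)
    · exact hu₀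
    · exact hu j

theorem isHFraction_hankelCF {n : ℕ} (hn : 2 ≤ n) : IsHFraction (hankelCF n) := by
  obtain ⟨K, h0, hK⟩ := exists_exponents_hankelCF hn
  refine isHFraction_of_isHLink rfl (fun p hp => ⟨1, -1, one_ne_zero, by simp, ?_⟩) hK
  rw [hankelCF_get?_zero, Option.some_inj] at hp
  rw [← hp, h0]
  constructor <;> simp
  ring

end Chain

/-! ### Rational identities for the complete quotients. -/

section Identities

variable {K : Type*} [Field K]

/-- The linear coefficient of the quadratic equation of the `q`-deformed metallic number. -/
def remB (x : K) (n : ℕ) : K := qAngle x n - 2 * x * qInt x n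

/-- The numerators of the complete quotients at the beginnings of the parts of `U_n`. -/
def remNumU (x : K) (n i : ℕ) : K := -remB x n + 1 - x - qInt x (n - i) * (1 - x + x ^ 2)

/-- The denominators of the complete quotients at the beginnings of the parts of `U_n`. -/
def remDenU (x : K) (n i : ℕ) : K :=
  (remB x n - 2 + x + qInt x (i + 1) + qInt x (n - i) * (1 - x + x ^ 2)) / (1 - x)

/-- The numerators of the complete quotients at the beginnings of the parts of `W_n`. -/
def remNumW (x : K) (n i : ℕ) : K := -remB x n + 1 - qInt x (n - i)

/-- The denominators of the complete quotients at the beginnings of the parts of `W_n`. -/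
def remDenW (x : K) (n i : ℕ) : K :=
  (remB x n - 2 + x + qInt x (i + 1) * (1 - x + x ^ 2) + qInt x (n - i)) / (1 - x)

theorem qInt_eq_div {x : K} (hx : 1 - x ≠ 0) (m : ℕ) : qInt x m = (1 - x ^ m) / (1 - x) := by
  rw [eq_div_iff hx, mul_comm, one_sub_mul_qInt]

theorem remB_eq {x : K} (n : ℕ) : remB x n = (1 + x ^ n) * (1 - x) - x * qInt x n := by
  rw [remB, qAngle]; ring

/-- This and the next identities supply the relations required by `evalList_cons_mul_eq`. Writing n
= i + k and [m] = (1 - xᵐ)/(1 - x) makes it an identity of rational functions in x, xⁱ and xᵏ. -/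
theorem remU_one {x : K} (hx : 1 - x ≠ 0) {n i : ℕ} (hi : i ≤ n) :
    x ^ (n - i) * remDenU x n i * (1 - x + x ^ 2) =
      x - remNumU x n i * (remNumU x n i + remB x n) := by
  obtain ⟨k, rfl⟩ := Nat.exists_eq_add_of_le hi
  rw [remDenU, remNumU, remB_eq, Nat.add_sub_cancel_left]
  simp only [qInt_eq_div hx]
  field_simp
  ring

theorem remU_two {x : K} (hx : 1 - x ≠ 0) (n : ℕ) :
    x ^ n * (1 - x + x ^ 2) * 1 = x - (x - 1) * (x - 1 + remB x n) := by
  rw [remB_eq]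
  simp only [qInt_eq_div hx]
  field_simp
  ring

theorem remU_three {x : K} (hx : 1 - x ≠ 0) {n i : ℕ} (hi : i + 1 ≤ n) :
    x ^ (i + 2) * 1 * remDenU x n (i + 1) =
      x - (-remB x n + 1 - qInt x (i + 2)) * (-remB x n + 1 - qInt x (i + 2) + remB x n) := by
  obtain ⟨k, rfl⟩ := Nat.exists_eq_add_of_le hi
  rw [remDenU, remB_eq, Nat.add_sub_cancel_left]
  simp only [qInt_eq_div hx]
  field_simp
  ring

theorem remU_three' {x : K} (hx : 1 - x ≠ 0) (n i : ℕ) :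
    -remB x n + 1 - qInt x (i + 2) + remNumU x n (i + 1) + (1 - x) * remDenU x n (i + 1) =
      -remB x n := by
  rw [remDenU, remNumU, mul_div_cancel₀ _ hx]
  ring

theorem remW_one {x : K} (hx : 1 - x ≠ 0) {n i : ℕ} (hi : i ≤ n) :
    x ^ (n - i) * remDenW x n i * 1 = x - remNumW x n i * (remNumW x n i + remB x n) := by
  obtain ⟨k, rfl⟩ := Nat.exists_eq_add_of_le hi
  rw [remDenW, remNumW, remB_eq, Nat.add_sub_cancel_left]
  simp only [qInt_eq_div hx]
  field_simp
  ring

theorem remW_three {x : K} (hx : 1 - x ≠ 0) {n i : ℕ} (hi : i + 1 ≤ n) :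
    x ^ (i + 2) * (1 - x + x ^ 2) * remDenW x n (i + 1) =
      x - (-remB x n + 1 - x - qInt x (i + 2) * (1 - x + x ^ 2)) *
        (-remB x n + 1 - x - qInt x (i + 2) * (1 - x + x ^ 2) + remB x n) := by
  obtain ⟨k, rfl⟩ := Nat.exists_eq_add_of_le hi
  rw [remDenW, remB_eq, Nat.add_sub_cancel_left]
  simp only [qInt_eq_div hx]
  field_simp
  ring

theorem remW_three' {x : K} (hx : 1 - x ≠ 0) (n i : ℕ) :
    -remB x n + 1 - x - qInt x (i + 2) * (1 - x + x ^ 2) + remNumW x n (i + 1) +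
      (1 - x) * remDenW x n (i + 1) = -remB x n := by
  rw [remDenW, remNumW, mul_div_cancel₀ _ hx]
  ring

theorem remNumU_zero {x : K} (hx : 1 - x ≠ 0) (n : ℕ) : remNumU x n 0 = x - 1 := by
  rw [remNumU, remB_eq, Nat.sub_zero]
  simp only [qInt_eq_div hx]
  field_simp
  ring

theorem remDenU_zero {x : K} (hx : 1 - x ≠ 0) (n : ℕ) : remDenU x n 0 = 1 := by
  rw [remDenU, remB_eq, Nat.sub_zero]
  simp only [qInt_eq_div hx]
  field_simp
  ring

theorem remNumW_zero {x : K} (hx : 1 - x ≠ 0) (n : ℕ) : remNumW x n 0 = x - 1 + x ^ (n + 1) := by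
  rw [remNumW, remB_eq, Nat.sub_zero]
  simp only [qInt_eq_div hx]
  field_simp
  ring

theorem remDenW_zero {x : K} (hx : 1 - x ≠ 0) (n : ℕ) : remDenW x n 0 = qInt x (n + 1) - x := by
  rw [remDenW, remB_eq, Nat.sub_zero]
  simp only [qInt_eq_div hx]
  field_simp
  ring

theorem qAngle_eq {x : K} (hx : 1 - x ≠ 0) (n : ℕ) :
    qAngle x n = x * ((1 - x ^ n) / (1 - x)) + (1 + x ^ n) * (1 - x) := by
  rw [qAngle, qInt_eq_div hx]

end Identities

/-! ### Complete quotients through one period. -/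

section Remainders

local notation "v" => (Valued.v : Valuation (LaurentSeries ℚ) (WithZero (Multiplicative ℤ)))

local notation "𝐪" => q ℚ

theorem valuation_polyToLaurent_le_one (u : Polynomial ℚ) : v (polyToLaurent u) ≤ 1 :=
  valuation_coe_le_one _

theorem ne_zero_of_eq_one_add {y : LaurentSeries ℚ} (u : Polynomial ℚ)
    (h : y = 1 + 𝐪 * polyToLaurent u) : y ≠ 0 := by
  rintro rfl
  have := valuation_one_add_q_mul (valuation_polyToLaurent_le_one u)
  simp [← h] at this

theorem remDenU_ne_zero {n i : ℕ} (hi : i < n) : remDenU 𝐪 n i ≠ 0 := by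
  obtain ⟨k, rfl⟩ := Nat.exists_eq_add_of_lt hi
  apply div_ne_zero _ one_sub_q_ne_zero
  let X : Polynomial ℚ := Polynomial.X
  -- The numerator of `remDenU` is a polynomial with constant term 1, displayed here as 1 + q times
  -- a polynomial.
  apply ne_zero_of_eq_one_add (X ^ (i + k) * (1 - X) - qInt X (i + k + 1) + qInt X i +
    (qInt X k) * (1 - X + X ^ 2) + (X - 1))
  simp only [map_add, map_sub, map_mul, map_one, map_pow, polyToLaurent_qInt, polyToLaurent_X,
    remB_eq, X]
  rw [show i + k + 1 - i = k + 1 by omega, qInt_succ _ i, qInt_succ _ k]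
  ring

theorem remDenW_ne_zero {n i : ℕ} (hi : i < n) : remDenW 𝐪 n i ≠ 0 := by
  obtain ⟨k, rfl⟩ := Nat.exists_eq_add_of_lt hi
  apply div_ne_zero _ one_sub_q_ne_zero
  let X : Polynomial ℚ := Polynomial.X
  apply ne_zero_of_eq_one_add (X ^ (i + k) * (1 - X) - qInt X (i + k + 1) + qInt X k +
    (qInt X i) * (1 - X + X ^ 2) + (X - 1))
  simp only [map_add, map_sub, map_mul, map_one, map_pow, polyToLaurent_qInt, polyToLaurent_X,
    remB_eq, X]
  rw [show i + k + 1 - i = k + 1 by omega, qInt_succ _ i, qInt_succ _ k]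
  ring

theorem one_sub_q_add_sq_ne_zero : 1 - 𝐪 + 𝐪 ^ 2 ≠ 0 :=
  ne_zero_of_eq_one_add (-1 + Polynomial.X) (by simp; ring)

/-- The value of the finite continued fraction with the partial quotients `l` and the tail `x`. -/
noncomputable def evalList (l : List (Pair (LaurentSeries ℚ))) (x : LaurentSeries ℚ) : LaurentSeries ℚ :=
  l.foldr (fun p t => p.a / (p.b + t)) x

theorem evalList_append (l l' : List (Pair (LaurentSeries ℚ))) (x : LaurentSeries ℚ) :
    evalList (l ++ l') x = evalList l (evalList l' x) := List.foldr_append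

theorem valuation_evalList_le {k k' : ℕ} {l : List (Pair (LaurentSeries ℚ))} (hl : IsHChain k l k')
    {x : LaurentSeries ℚ} (hx : v x ≤ v 𝐪) : v (evalList l x) ≤ v 𝐪 := by
  induction l generalizing k with
  | nil => exact hx
  | cons p l ih =>
    obtain ⟨k₁, hp, hl⟩ := hl
    exact (valuation_div_add hp.valuation_b (ih hl)).trans_le hp.valuation_a

/-- By `h1` and the quadratic equation, (ψ + s)(ψ + s' + bt') = (ψ + s)(ψ - B - s) = q - s(s + B),
which `h2` identifies with att'. The chain and the bound on x keep the denominator a unit. -/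
theorem evalList_cons_mul_eq {k k' n : ℕ} {l : List (Pair (LaurentSeries ℚ))}
    {r : Pair (LaurentSeries ℚ)} (hl : IsHChain k (r :: l) k') {ψ x s t s' t' : LaurentSeries ℚ}
    (hx : v x ≤ v 𝐪) (hψ : ψ ^ 2 = 𝐪 + remB 𝐪 n * ψ) (h : evalList l x * t' = ψ + s')
    (ht' : t' ≠ 0) (h1 : s + s' + r.b * t' = -remB 𝐪 n)
    (h2 : r.a * t * t' = 𝐪 - s * (s + remB 𝐪 n)) :
    evalList (r :: l) x * t = ψ + s := by
  obtain ⟨k₁, hr, hl⟩ := hl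
  have hv := valuation_add_eq_one hr.valuation_b (valuation_evalList_le hl hx)
  have h0 : r.b + evalList l x ≠ 0 := by intro h0; simp [h0] at hv
  have ha := hr.a_ne_zero
  change r.a / (r.b + evalList l x) * t = ψ + s
  rw [div_mul_eq_mul_div, div_eq_iff h0]
  apply mul_right_cancel₀ ht'
  linear_combination h2 - (ψ + s) * h - (ψ + s) * h1 - hψ

variable {n : ℕ} {ψ y : LaurentSeries ℚ}

theorem evalList_partU (hψ : ψ ^ 2 = 𝐪 + remB 𝐪 n * ψ) (hy : v y ≤ v 𝐪) {i : ℕ}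
    (hi : i + 2 < n) (h : y * remDenU 𝐪 n (i + 1) = ψ + remNumU 𝐪 n (i + 1)) :
    evalList [⟨𝐪 ^ (n - i), qInt 𝐪 (n - i)⟩, ⟨𝐪 ^ n, qInt 𝐪 (i + 2) - 𝐪⟩, ⟨𝐪 ^ (i + 2), 1 - 𝐪⟩] y
      * remDenU 𝐪 n i = ψ + remNumU 𝐪 n i := by
  have hq := one_sub_q_ne_zero (F := ℚ)
  have c3 : IsHChain i [⟨𝐪 ^ (i + 2), 1 - 𝐪⟩] 0 := ⟨0, isHLink_one_sub (by omega), rfl⟩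
  have c2 : IsHChain (n - i - 2) [⟨𝐪 ^ n, qInt 𝐪 (i + 2) - 𝐪⟩, ⟨𝐪 ^ (i + 2), 1 - 𝐪⟩] 0 :=
    ⟨i, isHLink_qInt_sub (by omega), c3⟩
  have c1 : IsHChain 0 [⟨𝐪 ^ (n - i), qInt 𝐪 (n - i)⟩, ⟨𝐪 ^ n, qInt 𝐪 (i + 2) - 𝐪⟩,
      ⟨𝐪 ^ (i + 2), 1 - 𝐪⟩] 0 := by
    refine ⟨n - i - 2, ?_, c2⟩
    have := isHLink_qInt (k := 0) (k' := n - i - 2) (m := n - i) (by omega)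
    rwa [show n - i - 2 + 2 = n - i by omega] at this
  -- From the inside outwards, the denominators t are 1, then 1 - q + q², then `remDenU 𝐪 n i`.
  have s3 := evalList_cons_mul_eq c3 hy hψ h (remDenU_ne_zero (by omega)) (remU_three' hq n i)
    (remU_three hq (by omega))
  have s2 := evalList_cons_mul_eq c2 hy hψ s3 one_ne_zero (by ring) (remU_two hq n)
  exact evalList_cons_mul_eq c1 hy hψ s2 one_sub_q_add_sq_ne_zero (by rw [remNumU]; ring)
    (remU_one hq (by omega))

theorem evalList_partW (hψ : ψ ^ 2 = 𝐪 + remB 𝐪 n * ψ) (hy : v y ≤ v 𝐪) {i : ℕ}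
    (hi : i + 2 < n) (h : y * remDenW 𝐪 n (i + 1) = ψ + remNumW 𝐪 n (i + 1)) :
    evalList [⟨𝐪 ^ (n - i), qInt 𝐪 (n - i) - 𝐪⟩, ⟨𝐪 ^ n, qInt 𝐪 (i + 2)⟩, ⟨𝐪 ^ (i + 2), 1 - 𝐪⟩] y
      * remDenW 𝐪 n i = ψ + remNumW 𝐪 n i := by
  have hq := one_sub_q_ne_zero (F := ℚ)
  have c3 : IsHChain i [⟨𝐪 ^ (i + 2), 1 - 𝐪⟩] 0 := ⟨0, isHLink_one_sub (by omega), rfl⟩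
  have c2 : IsHChain (n - i - 2) [⟨𝐪 ^ n, qInt 𝐪 (i + 2)⟩, ⟨𝐪 ^ (i + 2), 1 - 𝐪⟩] 0 :=
    ⟨i, isHLink_qInt (by omega), c3⟩
  have c1 : IsHChain 0 [⟨𝐪 ^ (n - i), qInt 𝐪 (n - i) - 𝐪⟩, ⟨𝐪 ^ n, qInt 𝐪 (i + 2)⟩,
      ⟨𝐪 ^ (i + 2), 1 - 𝐪⟩] 0 := by
    refine ⟨n - i - 2, ?_, c2⟩
    have := isHLink_qInt_sub (k := 0) (k' := n - i - 2) (m := n - i) (by omega)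
    rwa [show n - i - 2 + 2 = n - i by omega] at this
  -- Compared with `evalList_partU`, the intermediate denominators 1 and 1 - q + q² trade places.
  have s3 := evalList_cons_mul_eq c3 hy hψ h (remDenW_ne_zero (by omega)) (remW_three' hq n i)
    (remW_three hq (by omega))
  have s2 := evalList_cons_mul_eq (s := 𝐪 - 1) (t := 1) c2 hy hψ s3 one_sub_q_add_sq_ne_zero
    (by ring) (by linear_combination remU_two hq n)
  exact evalList_cons_mul_eq c1 hy hψ s2 one_ne_zero (by rw [remNumW]; ring)
    (remW_one hq (by omega))

theorem evalList_flatMap_range {f : ℕ → List (Pair (LaurentSeries ℚ))} {s t : ℕ → LaurentSeries ℚ}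
    {m : ℕ} (hf : ∀ i < m, IsHChain 0 (f i) 0)
    (h : ∀ i < m, ∀ y, v y ≤ v 𝐪 → y * t (i + 1) = ψ + s (i + 1) →
      evalList (f i) y * t i = ψ + s i)
    (hy : v y ≤ v 𝐪) (h0 : y * t m = ψ + s m) :
    evalList ((List.range m).flatMap f) y * t 0 = ψ + s 0 := by
  induction m generalizing y with
  | zero => exact h0
  | succ m ih =>
    rw [List.range_succ, List.flatMap_append, evalList_append, List.flatMap_singleton]
    exact ih (fun i hi => hf i (by omega)) (fun i hi => h i (by omega))
      (valuation_evalList_le (hf m (by omega)) hy) (h m (by omega) y hy h0)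

theorem evalList_blockW (hn : 2 ≤ n) (hψ : ψ ^ 2 = 𝐪 + remB 𝐪 n * ψ) (hy : v y ≤ v 𝐪)
    (h : y = ψ + (𝐪 - 1)) :
    evalList (blockW n) y * (qInt 𝐪 (n + 1) - 𝐪) = ψ + (𝐪 - 1 + 𝐪 ^ (n + 1)) := by
  have hq := one_sub_q_ne_zero (F := ℚ)
  have c : IsHChain 0 [⟨𝐪 ^ 2, (1 : LaurentSeries ℚ)⟩] 0 := ⟨0, isHLink_one (by omega), rfl⟩
  have s1 := evalList_cons_mul_eq (t := remDenW 𝐪 n (n - 2)) (s := remNumW 𝐪 n (n - 2)) (t' := 1)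
    c hy hψ ((mul_one y).trans h) one_ne_zero
    (by rw [remNumW, Nat.sub_sub_self hn]; simp [qInt, Finset.sum_range_succ]; ring)
    (by have := remW_one hq (n := n) (i := n - 2) (by omega); rwa [Nat.sub_sub_self hn] at this)
  rw [← remDenW_zero hq, ← remNumW_zero hq, blockW, evalList_append]
  refine evalList_flatMap_range (fun i hi => ?_) (fun i hi y hy h => ?_)
    (valuation_evalList_le c hy) s1
  · refine ⟨n - i - 2, ?_, i, isHLink_qInt (by omega), 0, isHLink_one_sub (by omega), rfl⟩
    have := isHLink_qInt_sub (k := 0) (k' := n - i - 2) (m := n - i) (by omega)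
    rwa [show n - i - 2 + 2 = n - i by omega] at this
  · exact evalList_partW hψ hy (by omega) h

theorem evalList_blockU (hn : 2 ≤ n) (hψ : ψ ^ 2 = 𝐪 + remB 𝐪 n * ψ) (hy : v y ≤ v 𝐪)
    (h : y * (qInt 𝐪 (n + 1) - 𝐪) = ψ + (𝐪 - 1 - 𝐪 ^ n)) :
    evalList (blockU n) y = ψ + (𝐪 - 1) := by
  have hq := one_sub_q_ne_zero (F := ℚ)
  obtain ⟨k, rfl⟩ := Nat.exists_eq_add_of_le' hn
  have c3 : IsHChain k [⟨𝐪 ^ (k + 2), (1 : LaurentSeries ℚ)⟩] 0 := ⟨0, isHLink_one (by omega), rfl⟩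
  have c2 : IsHChain 0 [⟨𝐪 ^ (k + 2), qInt 𝐪 (k + 2) - 𝐪⟩, ⟨𝐪 ^ (k + 2), 1⟩] 0 :=
    ⟨k, isHLink_qInt_sub (by omega), c3⟩
  have c1 : IsHChain 0 [⟨𝐪 ^ 2, qInt 𝐪 2⟩, ⟨𝐪 ^ (k + 2), qInt 𝐪 (k + 2) - 𝐪⟩,
      ⟨𝐪 ^ (k + 2), 1⟩] 0 :=
    ⟨0, isHLink_qInt (by omega), c2⟩
  have s3 := evalList_cons_mul_eq (t := 1) (s := -remB 𝐪 (k + 2) + 1 - qInt 𝐪 (k + 2))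
    c3 hy hψ h
    (by rw [← remDenW_zero hq]; exact remDenW_ne_zero (by omega))
    (by simp only [qInt_succ' _ (k + 2)]; ring)
    (by rw [remB_eq]; simp only [qInt_eq_div hq]; field_simp; ring)
  have s2 := evalList_cons_mul_eq c2 hy hψ s3 one_ne_zero (by ring) (remU_two hq (k + 2))
  have s1 := evalList_cons_mul_eq (t := remDenU 𝐪 (k + 2) k) (s := remNumU 𝐪 (k + 2) k)
    c1 hy hψ s2 one_sub_q_add_sq_ne_zero (by rw [remNumU, Nat.add_sub_cancel_left]; ring)
    (by have := remU_one hq (n := k + 2) (i := k) (by omega); rwa [Nat.add_sub_cancel_left] at this)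
  have key := evalList_flatMap_range (f := fun i => [⟨𝐪 ^ (k + 2 - i), qInt 𝐪 (k + 2 - i)⟩,
     ⟨𝐪 ^ (k + 2), qInt 𝐪 (i + 2) - 𝐪⟩, ⟨𝐪 ^ (i + 2), 1 - 𝐪⟩]) (t := remDenU 𝐪 (k + 2))
     (s := remNumU 𝐪 (k + 2)) (m := k) (fun i hi => ?_) (fun i hi y hy h => ?_)
    (valuation_evalList_le c1 hy) s1
  · rw [remDenU_zero hq, remNumU_zero hq, mul_one] at key
    rw [blockU, evalList_append]
    exact key
  · refine ⟨k - i, ?_, i, isHLink_qInt_sub (by omega), 0, isHLink_one_sub (by omega), rfl⟩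
    have := isHLink_qInt (k := 0) (k' := k - i) (m := k + 2 - i) (by omega)
    rwa [show k - i + 2 = k + 2 - i by omega] at this
  · exact evalList_partU hψ hy (by omega) h

/-- This block joins the other two: both ends have denominator [n + 1] - q, and the three quotients
strictly between have denominator 1. -/
theorem evalList_blockV (hn : 1 ≤ n) (hψ : ψ ^ 2 = 𝐪 + remB 𝐪 n * ψ) (hy : v y ≤ v 𝐪)
    (h : y * (qInt 𝐪 (n + 1) - 𝐪) = ψ + (𝐪 - 1 + 𝐪 ^ (n + 1))) :
    evalList (blockV n) y * (qInt 𝐪 (n + 1) - 𝐪) = ψ + (𝐪 - 1 - 𝐪 ^ n) := by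
  have hq := one_sub_q_ne_zero (F := ℚ)
  obtain ⟨k₁, l₁, k₂, l₂, k₃, l₃, k₄, l₄, l₅⟩ := isHChain_blockV hn
  have c4 : IsHChain k₃ [⟨-𝐪 ^ (n + 1), 1⟩] 0 := ⟨k₄, l₄, l₅⟩
  have c3 : IsHChain k₂ [⟨𝐪 ^ (2 * n + 1), qAngle 𝐪 n + 𝐪 ^ (n + 1)⟩, ⟨-𝐪 ^ (n + 1), 1⟩] 0 :=
    ⟨k₃, l₃, c4⟩
  have c2 : IsHChain k₁ [⟨𝐪 ^ (2 * n + 1), qAngle 𝐪 n⟩,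
      ⟨𝐪 ^ (2 * n + 1), qAngle 𝐪 n + 𝐪 ^ (n + 1)⟩, ⟨-𝐪 ^ (n + 1), 1⟩] 0 := ⟨k₂, l₂, c3⟩
  have s4 := evalList_cons_mul_eq (t := 1) (s := 𝐪 - 1 - 𝐪 ^ n) c4 hy hψ h
    (by rw [← remDenW_zero hq]; exact remDenW_ne_zero (by omega))
    (by simp only [remB_eq, qInt_eq_div hq]; field_simp; ring)
    (by simp only [remB_eq, qInt_eq_div hq]; field_simp; ring)
  have s3 := evalList_cons_mul_eq (t := 1) (s := 𝐪 - 1 - 𝐪 ^ n + 𝐪 ^ (n + 1))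
    c3 hy hψ s4 one_ne_zero
    (by simp only [remB_eq, qAngle_eq hq, qInt_eq_div hq]; field_simp; ring)
    (by simp only [remB_eq, qInt_eq_div hq]; field_simp; ring)
  have s2 := evalList_cons_mul_eq (t := 1) (s := 𝐪 - 1 - 𝐪 ^ n + 𝐪 ^ (n + 1))
    c2 hy hψ s3 one_ne_zero
    (by simp only [remB_eq, qAngle_eq hq, qInt_eq_div hq]; field_simp; ring)
    (by simp only [remB_eq, qInt_eq_div hq]; field_simp; ring)
  exact evalList_cons_mul_eq (isHChain_blockV hn) hy hψ s2 one_ne_zero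
    (by simp only [remB_eq, qAngle_eq hq, qInt_eq_div hq]; field_simp; ring)
    (by simp only [remB_eq, qInt_eq_div hq]; field_simp; ring)

theorem evalList_period (hn : 2 ≤ n) (hψ : ψ ^ 2 = 𝐪 + remB 𝐪 n * ψ)
    (hy : v (ψ + (𝐪 - 1)) ≤ v 𝐪) :
    evalList (period n) (ψ + (𝐪 - 1)) = ψ + (𝐪 - 1) := by
  rw [period, evalList_append, evalList_append]
  have hW := valuation_evalList_le (isHChain_blockW hn) hy
  have hV := valuation_evalList_le (isHChain_blockV (n := n) (by omega)) hW
  exact evalList_blockU hn hψ hV (evalList_blockV (by omega) hψ hW (evalList_blockW hn hψ hy rfl))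

end Remainders

/-! ### Convergence of the periodic fraction. -/

section Convergence

local notation "v" => (Valued.v : Valuation (LaurentSeries ℚ) (WithZero (Multiplicative ℤ)))

local notation "𝐪" => q ℚ

/-- Truncation replaces one complete quotient, of valuation at most v(q), by 0; each of the m levels
above multiplies the error by a further v(q) at most. -/
theorem valuation_convs'Aux_sub_le {s : Stream'.Seq (Pair (LaurentSeries ℚ))}
    (hs : IsContracting s) {r : ℕ → LaurentSeries ℚ} (hr : ∀ j, v (r j) ≤ v 𝐪)
    (h : ∀ j, ∃ p, s.get? j = some p ∧ r j = p.a / (p.b + r (j + 1))) (m : ℕ) :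
    v (convs'Aux s m - r 0) ≤ v 𝐪 ^ (m + 1) := by
  induction m generalizing s r with
  | zero => simpa [convs'Aux] using hr 0
  | succ m ih =>
    obtain ⟨p, hp, h0⟩ := h 0
    have h1 := hs 0 p hp
    rw [convs'Aux_succ_some hp, h0, valuation_div_add_sub_div_add h1.2
      (valuation_convs'Aux_le hs.tail m) (hr _), pow_succ' _ (m + 1)]
    exact mul_le_mul' h1.1 (ih (r := fun j => r (j + 1)) hs.tail (fun j => hr _)
      fun j => by simpa only [Stream'.Seq.get?_tail] using h (j + 1))

theorem isContracting_of_isHLink {s : Stream'.Seq (Pair (LaurentSeries ℚ))} {K : ℕ → ℕ}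
    (h : ∀ j p, s.get? j = some p → IsHLink (K j) (K (j + 1)) p) : IsContracting s :=
  fun j p hp => ⟨(h j p hp).valuation_a, (h j p hp).valuation_b⟩

variable {n : ℕ}

theorem Phi_ne_zero (hn : 1 ≤ n) : Phi n ≠ 0 := by
  intro h
  have := valuation_Phi hn
  simp [h] at this

theorem inv_Phi (hn : 1 ≤ n) : (Phi n)⁻¹ = 𝐪 * Phi n + remB 𝐪 n := by
  apply inv_eq_of_mul_eq_one_left
  rw [remB]
  linear_combination Phi_quadratic hn

theorem inv_Phi_sq (hn : 1 ≤ n) : (Phi n)⁻¹ ^ 2 = 𝐪 + remB 𝐪 n * (Phi n)⁻¹ := by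
  have h := Phi_ne_zero hn
  rw [sq]
  nth_rw 1 [inv_Phi hn]
  field_simp

/-- Since 1/Φ = qΦ + B and B is 1 modulo q, subtracting 1 - q leaves a multiple of q. This makes y
admissible as the value of a contracting tail. -/
theorem valuation_inv_Phi_add_le (hn : 1 ≤ n) : v ((Phi n)⁻¹ + (𝐪 - 1)) ≤ v 𝐪 := by
  have h : (Phi n)⁻¹ + (𝐪 - 1) =
      𝐪 * (Phi n + (𝐪 ^ (n - 1) - 𝐪 ^ n) - qInt 𝐪 n) := by
    rw [inv_Phi hn, remB_eq]
    obtain ⟨m, rfl⟩ := Nat.exists_eq_add_of_le' hn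
    rw [Nat.add_sub_cancel]
    ring
  rw [h, map_mul]
  apply mul_le_of_le_one_right'
  apply Valuation.map_sub_le _ (Valuation.map_add_le _ (valuation_Phi hn).le _)
    (valuation_qInt_le_one n)
  exact Valuation.map_sub_le _ (valuation_q_pow_le_one _) (valuation_q_pow_le_one _)

theorem evalList_drop_period (hn : 2 ≤ n) {y : LaurentSeries ℚ} (hy : evalList (period n) y = y)
    (j : ℕ) : ∃ p, (hankelCF n).s.tail.get? j = some p ∧
      evalList ((period n).drop (j % (period n).length)) y =
        p.a / (p.b + evalList ((period n).drop ((j + 1) % (period n).length)) y) := by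
  have hl := List.length_pos_of_ne_nil (period_ne_nil n)
  have h1 := length_period hn
  have hj := Nat.mod_lt j hl
  refine ⟨_, (Stream'.Seq.get?_tail _ _).trans (hankelCF_get?_succ n j), ?_⟩
  rw [List.drop_eq_getElem_cons hj]
  change _ / (_ + evalList _ y) = _
  rw [Nat.add_mod_eq_ite, Nat.mod_eq_of_lt (show 1 < (period n).length by omega)]
  -- At the end of the period the remaining list is empty, and `hy` turns its value y back into the
  -- value of a whole period.
  split_ifs with h
  · rw [show j % (period n).length + 1 = (period n).length by omega, Nat.sub_self,
      List.drop_length, List.drop_zero, hy]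
    rfl
  · rfl

theorem isContracting_hankelCF_tail (hn : 2 ≤ n) : IsContracting (hankelCF n).s.tail := by
  obtain ⟨K, -, hK⟩ := exists_exponents_hankelCF hn
  exact isContracting_of_isHLink fun j p hp => hK j p (by rwa [Stream'.Seq.get?_tail] at hp)

theorem valuation_one_sub_q : v (1 - 𝐪) = 1 :=
  Valuation.map_one_sub_of_lt _ valuation_q_lt_one

theorem convergesTo_hankelCF (hn : 2 ≤ n) : ConvergesTo (hankelCF n) (Phi n) := by
  have hn1 : 1 ≤ n := by omega
  have hs := isContracting_hankelCF_tail hn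
  set y := (Phi n)⁻¹ + (𝐪 - 1) with hy
  have hv : v y ≤ v 𝐪 := valuation_inv_Phi_add_le hn1
  have he : evalList (period n) y = y := evalList_period hn (inv_Phi_sq hn1) hv
  have hconv : ∀ m, convs (hankelCF n) m = convs'Aux (hankelCF n).s m := by
    apply convs_zero_eq_convs'Aux hs
    intro p hp
    rw [hankelCF_get?_zero, Option.some_inj] at hp
    rw [← hp]
    exact valuation_one_sub_q
  have hr : ∀ j, v (evalList ((period n).drop (j % (period n).length)) y) ≤ v 𝐪 := by
    intro j
    obtain ⟨K, -, -, hK⟩ := (isHChain_period hn).exists_exponents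
    generalize j % (period n).length = i
    induction hd : (period n).length - i generalizing i with
    | zero => rwa [List.drop_eq_nil_of_le (by omega)]
    | succ d ih =>
      have hi : i < (period n).length := by omega
      rw [List.drop_eq_getElem_cons hi]
      exact (valuation_div_add (hK i hi).valuation_b (ih (i + 1) (by omega))).trans_le
        (hK i hi).valuation_a
  apply tendsto_of_valuation_sub_le
  intro m
  change v (convs (hankelCF n) m - Phi n) ≤ _
  rw [hconv]
  cases m with
  | zero => simp [convs'Aux, valuation_Phi hn1]
  | succ m =>
    have h1 := valuation_convs'Aux_sub_le hs hr (evalList_drop_period hn he) m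
    rw [Nat.zero_mod, List.drop_zero, he] at h1
    -- The initial partial quotient is treated separately: its numerator 1 does not contract, but it
    -- does not enlarge the error either.
    have h2 : Phi n = 1 / (1 - 𝐪 + y) := by
      rw [hy, one_div, show 1 - 𝐪 + ((Phi n)⁻¹ + (𝐪 - 1)) = (Phi n)⁻¹ by ring, inv_inv]
    rw [convs'Aux_succ_some (hankelCF_get?_zero n), h2]
    simp only
    rw [valuation_div_add_sub_div_add valuation_one_sub_q (valuation_convs'Aux_le hs m) hv,
      map_one, one_mul]
    exact h1

end Convergence

/-! ### Uniqueness of Hankel expansions. -/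

section Uniqueness

local notation "v" => (Valued.v : Valuation (LaurentSeries ℚ) (WithZero (Multiplicative ℤ)))

local notation "𝐪" => q ℚ

/-- The partial quotients of a Hankel continued fraction whose first numerator is a scalar multiple
of a power of `q` with exponent at least `s`. -/
def IsHTail (s : ℕ) (S : Stream'.Seq (Pair (LaurentSeries ℚ))) : Prop :=
  ∃ K : ℕ → ℕ,
    (∀ p, S.get? 0 = some p → ∃ (c : ℚ) (u : Polynomial ℚ), c ≠ 0 ∧ u.natDegree ≤ K 0 ∧
      p.a = HahnSeries.C c * 𝐪 ^ (s + K 0) ∧ p.b = 1 + 𝐪 * polyToLaurent u) ∧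
    ∀ j p, S.get? (j + 1) = some p → IsHLink (K j) (K (j + 1)) p

theorem IsHFraction.isHTail {g : GenContFract (LaurentSeries ℚ)} (hg : IsHFraction g) :
    IsHTail 0 g.s := by
  obtain ⟨-, c, K, u, hc, hu, h0, h⟩ := hg
  refine ⟨K, fun p hp => ⟨c 0, u 1, hc 0, hu 0, ?_, (h0 p hp).2⟩,
    fun j p hp => ⟨c (j + 1), u (j + 2), hc _, hu _, (h j p hp).1, (h j p hp).2⟩⟩
  rw [zero_add]
  exact (h0 p hp).1

theorem IsHTail.tail {s : ℕ} {S : Stream'.Seq (Pair (LaurentSeries ℚ))} (h : IsHTail s S)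
    {p : Pair (LaurentSeries ℚ)} (hp : S.get? 0 = some p) :
    ∃ (c : ℚ) (k : ℕ) (u : Polynomial ℚ), c ≠ 0 ∧ u.natDegree ≤ k ∧
      p.a = HahnSeries.C c * 𝐪 ^ (s + k) ∧ p.b = 1 + 𝐪 * polyToLaurent u ∧
      IsHTail (k + 2) S.tail := by
  obtain ⟨K, h0, h⟩ := h
  obtain ⟨c, u, h1, h2, h3, h4⟩ := h0 p hp
  refine ⟨c, K 0, u, h1, h2, h3, h4, fun j => K (j + 1), fun p hp => ?_, fun j p hp => ?_⟩
  · rw [Stream'.Seq.get?_tail] at hp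
    obtain ⟨c, u, h1, h2, h3, h4⟩ := h 0 p hp
    -- The scalar absorbs the sign of the numerator, giving a tail the same shape as the initial
    -- fraction.
    refine ⟨-c, u, neg_ne_zero.2 h1, h2, ?_, h4⟩
    rw [h3, map_neg, add_right_comm]
  · rw [Stream'.Seq.get?_tail] at hp
    exact h (j + 1) p hp

theorem IsHTail.isContracting_tail {s : ℕ} {S : Stream'.Seq (Pair (LaurentSeries ℚ))}
    (h : IsHTail s S) : IsContracting S.tail := by
  obtain ⟨K, -, h⟩ := h
  exact isContracting_of_isHLink fun j p hp => h j p (by rwa [Stream'.Seq.get?_tail] at hp)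

theorem IsHTail.convs_eq {g : GenContFract (LaurentSeries ℚ)} (hg : g.h = 0)
    {s : ℕ} (h : IsHTail s g.s) (m : ℕ) : g.convs m = convs'Aux g.s m := by
  rw [← convs_zero_eq_convs'Aux h.isContracting_tail _ m, ← hg]
  intro p hp
  obtain ⟨c, k, u, -, -, -, h4, -⟩ := h.tail hp
  rw [h4]
  exact valuation_one_add_q_mul (valuation_polyToLaurent_le_one u)

theorem IsHTail.valuation_convs'Aux_succ {s k : ℕ} {S : Stream'.Seq (Pair (LaurentSeries ℚ))}
    (h : IsHTail s S) {p : Pair (LaurentSeries ℚ)} (hp : S.get? 0 = some p) {c : ℚ} (hc : c ≠ 0)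
    (hpa : p.a = HahnSeries.C c * 𝐪 ^ (s + k)) (m : ℕ) :
    v (convs'Aux S (m + 1)) = v 𝐪 ^ (s + k) := by
  obtain ⟨-, -, u, -, -, -, hb, -⟩ := h.tail hp
  rw [convs'Aux_succ_some hp, valuation_div_add _ (valuation_convs'Aux_le h.isContracting_tail m),
    hpa, map_mul, valuation_C hc, one_mul, map_pow]
  rw [hb]
  exact valuation_one_add_q_mul (valuation_polyToLaurent_le_one u)

theorem IsHTail.valuation_convs'Aux_le {s : ℕ} {S : Stream'.Seq (Pair (LaurentSeries ℚ))}
    (h : IsHTail s S) (m : ℕ) : v (convs'Aux S m) ≤ v 𝐪 ^ s := by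
  cases m with
  | zero => simp [convs'Aux]
  | succ m =>
    cases hp : S.get? 0 with
    | none => rw [convs'Aux_succ_none hp]; simp
    | some p =>
      obtain ⟨c, k, u, hc, -, ha, -, -⟩ := h.tail hp
      rw [h.valuation_convs'Aux_succ hp hc ha, pow_add]
      exact mul_le_of_le_one_right' (pow_le_one' valuation_q_lt_one.le k)

/-- The head of a Hankel continued fraction with value `Φ`, and the value of its tail. -/
theorem IsHTail.tendsto_tail {s : ℕ} {S : Stream'.Seq (Pair (LaurentSeries ℚ))}
    (h : IsHTail s S) {p : Pair (LaurentSeries ℚ)} (hp : S.get? 0 = some p) {Φ : LaurentSeries ℚ}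
    (hΦ : Tendsto (convs'Aux S) atTop (𝓝 Φ)) :
    ∃ (c : ℚ) (k : ℕ) (u : Polynomial ℚ) (R : LaurentSeries ℚ), c ≠ 0 ∧ u.natDegree ≤ k ∧
      p = ⟨HahnSeries.C c * 𝐪 ^ (s + k), 1 + 𝐪 * polyToLaurent u⟩ ∧ IsHTail (k + 2) S.tail ∧
      v Φ = v 𝐪 ^ (s + k) ∧ v R ≤ v 𝐪 ^ (k + 2) ∧
      Tendsto (convs'Aux S.tail) atTop (𝓝 R) ∧
      HahnSeries.C c * 𝐪 ^ (s + k) = (1 + 𝐪 * polyToLaurent u + R) * Φ := by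
  obtain ⟨c, k, u, hc, hu, ha, hb, ht⟩ := h.tail hp
  have hΦ' := hΦ.comp (tendsto_add_atTop_nat 1)
  have hv : v Φ = v 𝐪 ^ (s + k) :=
    valuation_eq_of_tendsto hΦ' fun m => h.valuation_convs'Aux_succ hp hc ha m
  have hΦ0 : Φ ≠ 0 := by
    rintro rfl
    rw [map_zero] at hv
    exact pow_ne_zero _ (by simp [q_ne_zero]) hv.symm
  -- Convergence of the tail is not assumed: solving the first level for the tail and using Φ ≠ 0
  -- yields its limit.
  have hR : Tendsto (convs'Aux S.tail) atTop (𝓝 (p.a / Φ - p.b)) := by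
    refine ((tendsto_const_nhds.div hΦ' hΦ0).sub_const p.b).congr fun m => ?_
    have hv1 : v (p.b + convs'Aux S.tail m) = 1 := by
      refine valuation_add_eq_one ?_ (QMetallic.valuation_convs'Aux_le h.isContracting_tail m)
      rw [hb]
      exact valuation_one_add_q_mul (valuation_polyToLaurent_le_one u)
    have h0 : p.b + convs'Aux S.tail m ≠ 0 := by intro h0; simp [h0] at hv1
    have ha0 : p.a ≠ 0 := by
      rw [ha]
      exact mul_ne_zero ((map_ne_zero HahnSeries.C).2 hc) (pow_ne_zero _ q_ne_zero)
    change p.a / convs'Aux S (m + 1) - p.b = _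
    rw [convs'Aux_succ_some hp]
    field_simp
    ring
  refine ⟨c, k, u, _, hc, hu, ?_, ht, hv,
    valuation_le_of_tendsto hR fun m => ht.valuation_convs'Aux_le m, hR, ?_⟩
  · rw [← ha, ← hb]
  · rw [← ha, ← hb]
    field_simp
    ring

theorem coeff_one_add_q_mul (u : Polynomial ℚ) (j : ℕ) :
    (1 + 𝐪 * polyToLaurent u).coeff (j : ℤ) = (1 + Polynomial.X * u).coeff j := by
  have : 1 + 𝐪 * polyToLaurent u = polyToLaurent (1 + Polynomial.X * u) := by simp
  rw [this, ← Polynomial.coeff_coe, ← LaurentSeries.coeff_coe_powerSeries]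
  rfl

/-- Below degree k + 2 neither remainder contributes. The constant coefficients give c = c', and
degrees 1 to k + 1 recover u entirely because of its degree bound. -/
theorem head_unique {c c' : ℚ} {k : ℕ} {u u' : Polynomial ℚ} {R R' : LaurentSeries ℚ}
    (hc : c ≠ 0) (hu : u.natDegree ≤ k) (hu' : u'.natDegree ≤ k)
    (hR : v R ≤ v 𝐪 ^ (k + 2)) (hR' : v R' ≤ v 𝐪 ^ (k + 2))
    (h : HahnSeries.C c' * (1 + 𝐪 * polyToLaurent u + R) =
      HahnSeries.C c * (1 + 𝐪 * polyToLaurent u' + R')) : c = c' ∧ u = u' ∧ R = R' := by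
  have hR0 : ∀ {R : LaurentSeries ℚ}, v R ≤ v 𝐪 ^ (k + 2) → ∀ j : ℕ, j < k + 2 →
      R.coeff (j : ℤ) = 0 := by
    intro R hR j hj
    rw [← map_pow, valuation_q_pow] at hR
    exact (LaurentSeries.valuation_le_iff_coeff_lt_eq_zero ℚ).1 hR j (by exact_mod_cast hj)
  have hcoeff : ∀ j : ℕ, j < k + 2 →
      c' * (1 + Polynomial.X * u).coeff j = c * (1 + Polynomial.X * u').coeff j := by
    intro j hj
    have := congrArg (fun f : LaurentSeries ℚ => f.coeff (j : ℤ)) h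
    simpa only [HahnSeries.C_mul_eq_smul, HahnSeries.coeff_smul, smul_eq_mul,
      HahnSeries.coeff_add, ← coeff_one_add_q_mul, hR0 hR j hj,
      hR0 hR' j hj, add_zero] using this
  have hcc : c = c' := by
    have := hcoeff 0 (by omega)
    simpa using this.symm
  subst hcc
  have huu : u = u' := by
    ext j
    by_cases hj : j ≤ k
    · have := mul_left_cancel₀ hc (hcoeff (j + 1) (by omega))
      simpa [Polynomial.coeff_one] using this
    · rw [Polynomial.coeff_eq_zero_of_natDegree_lt (by omega),
        Polynomial.coeff_eq_zero_of_natDegree_lt (by omega)]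
  subst huu
  exact ⟨rfl, rfl, add_left_cancel (mul_left_cancel₀ ((map_ne_zero HahnSeries.C).2 hc) h)⟩

/-- A nonempty fraction has a value of finite order, so 0 is the value of the empty one only. This
forces two expansions of the same value to end together. -/
theorem not_tendsto_zero_of_isHTail {s : ℕ} {S : Stream'.Seq (Pair (LaurentSeries ℚ))}
    (h : IsHTail s S) {p : Pair (LaurentSeries ℚ)} (hp : S.get? 0 = some p)
    (h0 : Tendsto (convs'Aux S) atTop (𝓝 0)) : False := by
  obtain ⟨c, k, u, R, hc, -, -, -, hv, -⟩ := h.tendsto_tail hp h0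
  rw [map_zero] at hv
  exact pow_ne_zero _ (by simp [q_ne_zero]) hv.symm

theorem eq_zero_of_tendsto_convs'Aux {S : Stream'.Seq (Pair (LaurentSeries ℚ))}
    (hS : S.get? 0 = none) {Φ : LaurentSeries ℚ} (hΦ : Tendsto (convs'Aux S) atTop (𝓝 Φ)) :
    Φ = 0 := by
  refine tendsto_nhds_unique hΦ (tendsto_const_nhds.congr fun m => ?_)
  cases m with
  | zero => rfl
  | succ m => rw [convs'Aux_succ_none hS]

theorem IsHTail.head_eq {s : ℕ} {S S' : Stream'.Seq (Pair (LaurentSeries ℚ))}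
    (h : IsHTail s S) (h' : IsHTail s S') {Φ : LaurentSeries ℚ}
    (hΦ : Tendsto (convs'Aux S) atTop (𝓝 Φ)) (hΦ' : Tendsto (convs'Aux S') atTop (𝓝 Φ))
    {p p' : Pair (LaurentSeries ℚ)} (hp : S.get? 0 = some p) (hp' : S'.get? 0 = some p') :
    p = p' ∧ ∃ s' R, IsHTail s' S.tail ∧ IsHTail s' S'.tail ∧
      Tendsto (convs'Aux S.tail) atTop (𝓝 R) ∧ Tendsto (convs'Aux S'.tail) atTop (𝓝 R) := by
  obtain ⟨c, k, u, R, hc, hu, rfl, ht, hv, hR, hlim, he⟩ := h.tendsto_tail hp hΦ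
  obtain ⟨c', k', u', R', hc', hu', rfl, ht', hv', hR', hlim', he'⟩ := h'.tendsto_tail hp' hΦ'
  -- Both exponents are read off from the order s + k of the common value.
  have hk : k = k' := by
    rw [hv, ← map_pow, ← map_pow, valuation_q_pow, valuation_q_pow, WithZero.exp_inj] at hv'
    omega
  subst hk
  have hΦ0 : Φ ≠ 0 := by
    rintro rfl
    rw [map_zero] at hv
    exact pow_ne_zero _ (by simp [q_ne_zero]) hv.symm
  obtain ⟨rfl, rfl, rfl⟩ := head_unique hc hu hu' hR hR' (c' := c') (by
    apply mul_right_cancel₀ hΦ0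
    linear_combination HahnSeries.C c * he' - HahnSeries.C c' * he)
  exact ⟨rfl, k + 2, R, ht, ht', hlim, hlim'⟩

/-- Two Hankel continued fractions with the same value have the same partial quotients. -/
theorem IsHTail.get?_eq {s : ℕ} {S S' : Stream'.Seq (Pair (LaurentSeries ℚ))}
    (h : IsHTail s S) (h' : IsHTail s S') {Φ : LaurentSeries ℚ}
    (hΦ : Tendsto (convs'Aux S) atTop (𝓝 Φ)) (hΦ' : Tendsto (convs'Aux S') atTop (𝓝 Φ)) (j : ℕ) :
    S.get? j = S'.get? j := by
  induction j generalizing s S S' Φ with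
  | zero =>
    cases hp : S.get? 0 with
    | none =>
      cases hp' : S'.get? 0 with
      | none => rfl
      | some p' =>
        rw [eq_zero_of_tendsto_convs'Aux hp hΦ] at hΦ'
        exact (not_tendsto_zero_of_isHTail h' hp' hΦ').elim
    | some p =>
      cases hp' : S'.get? 0 with
      | none =>
        rw [eq_zero_of_tendsto_convs'Aux hp' hΦ'] at hΦ
        exact (not_tendsto_zero_of_isHTail h hp hΦ).elim
      | some p' => rw [(h.head_eq h' hΦ hΦ' hp hp').1]
  | succ j ih =>
    cases hp : S.get? 0 with
    | none =>
      cases hp' : S'.get? 0 with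
      | none => rw [Stream'.Seq.get?_zero_eq_none.1 hp, Stream'.Seq.get?_zero_eq_none.1 hp']
      | some p' =>
        rw [eq_zero_of_tendsto_convs'Aux hp hΦ] at hΦ'
        exact (not_tendsto_zero_of_isHTail h' hp' hΦ').elim
    | some p =>
      cases hp' : S'.get? 0 with
      | none =>
        rw [eq_zero_of_tendsto_convs'Aux hp' hΦ'] at hΦ
        exact (not_tendsto_zero_of_isHTail h hp hΦ).elim
      | some p' =>
        obtain ⟨-, s', R, ht, ht', hR, hR'⟩ := h.head_eq h' hΦ hΦ' hp hp'
        have := ih ht ht' hR hR'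
        rwa [Stream'.Seq.get?_tail, Stream'.Seq.get?_tail] at this

theorem IsHFraction.tendsto_convs'Aux {g : GenContFract (LaurentSeries ℚ)} (hg : IsHFraction g)
    {Φ : LaurentSeries ℚ} (h : ConvergesTo g Φ) : Tendsto (convs'Aux g.s) atTop (𝓝 Φ) :=
  Tendsto.congr (fun m => hg.isHTail.convs_eq hg.1 m) h

/-- The Hankel continued fraction expansion of a Laurent series is unique. -/
theorem IsHFraction.eq_of_convergesTo {g g' : GenContFract (LaurentSeries ℚ)} (hg : IsHFraction g)
    (hg' : IsHFraction g') {Φ : LaurentSeries ℚ} (h : ConvergesTo g Φ) (h' : ConvergesTo g' Φ) :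
    g = g' :=
  GenContFract.ext (hg.1.trans hg'.1.symm) (Stream'.Seq.ext
    (hg.isHTail.get?_eq hg'.isHTail (hg.tendsto_convs'Aux h) (hg'.tendsto_convs'Aux h')))

end Uniqueness

/-! ### The explicit polynomial and the main theorem. -/

theorem qAngle_eq_sum {R : Type*} [CommRing R] (x : R) {n : ℕ} (hn : 2 ≤ n) :
    qAngle x n = 1 + ∑ i ∈ Finset.Ico 2 n, x ^ i + 2 * x ^ n - x ^ (n + 1) := by
  have h := Finset.sum_range_add_sum_Ico (fun i => x ^ i) hn
  have h1 : qInt x n + x ^ n = 1 + x * qInt x n := by rw [← qInt_succ, qInt_succ']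
  simp only [Finset.sum_range_succ, Finset.sum_range_zero] at h
  rw [← qInt] at h
  rw [qAngle]
  linear_combination -h1 - h

end QMetallic
theorem mainTheorem1 (n : ℕ) (hn : 2 ≤ n) :
    -- the explicit form of `⟨n⟩_q`
    QMetallic.qAngle (QMetallic.q ℚ) n =
      1 + ∑ i ∈ Finset.Ico 2 n, QMetallic.q ℚ ^ i + 2 * QMetallic.q ℚ ^ n
        - QMetallic.q ℚ ^ (n + 1) ∧
    -- the continued fraction defining `Φ_n` converges to `Φ_n`
    QMetallic.ConvergesTo (QMetallic.metallicCF n) (QMetallic.Phi n) ∧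
    -- the explicit continued fraction is an `H`-fraction and converges to `Φ_n`
    QMetallic.IsHFraction (QMetallic.hankelCF n) ∧
    QMetallic.ConvergesTo (QMetallic.hankelCF n) (QMetallic.Phi n) ∧
    -- it is the only `H`-fraction, finite or infinite, that does so
    (∀ g : GenContFract (LaurentSeries ℚ), QMetallic.IsHFraction g →
      QMetallic.ConvergesTo g (QMetallic.Phi n) → g = QMetallic.hankelCF n) ∧
    -- it is `(6 n - 4)`-periodic with offset `1`
    (∀ i : ℕ, 1 ≤ i →
      (QMetallic.hankelCF n).s.get? (i + (6 * n - 4)) = (QMetallic.hankelCF n).s.get? i) := by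
  
  have h := QMetallic.convergesTo_hankelCF hn
  have hF := QMetallic.isHFraction_hankelCF hn
  exact ⟨QMetallic.qAngle_eq_sum _ hn, QMetallic.convergesTo_metallicCF (by omega), hF, h,
    fun g hg hgΦ => hg.eq_of_convergesTo hF hgΦ h, fun i hi => QMetallic.hankelCF_periodic hn hi⟩
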